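/- Let $\Omega$ be either $\mathbb R^d$ or the flat torus $\mathbb R^d/\mathbb Z^d$, let $T,\delta,\lambda>0$, let $m_0$ be a probability measure on $\Omega$, and let $\Gamma=C([0,T];\Omega)$ with the topology of uniform convergence. Let $\Psi:\Omega\to\mathbb R$ be Lipschitz continuous, and let $\eta$ be a bounded, Lipschitz continuous, strictly positive function on $\mathbb R^d$ ($\mathbb Z^d$-periodic, i.e. a function on $\Omega$, in the case of the torus) for which there is a constant $C$ with $|\nabla\eta(y)|\le C\eta(y)$ at every point $y$ where $\eta$ is differentiable. Assume $\int_\Omega \Psi^-\,dm_0<\infty$ (which is automatic if $\Psi$ is bounded, in particular on the torus). For $\gamma,\omega\in\Gamma$ put $K(\gamma)=\frac12\int_0^T|\gamma'|^2dt$ if $\gamma\in H^1$ and $K(\gamma)=+\infty$ otherwise; $V(\gamma,\omega)=\frac12\int_0^T|\gamma'-\omega'|^2\,\eta(\gamma-\omega)\,dt$ if $\gamma-\omega\in H^1$ and $V(\gamma,\omega)=+\infty$ otherwise. For a Borel probability measure $Q$ on $\Gamma$ put $$F(\gamma,Q)=\delta K(\gamma)+\Psi(\gamma(T))+\lambda\int_\Gamma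 V(\gamma,\omega)\,dQ(\omega)\in(-\infty,+\infty].$$ A curve $\gamma$ is called optimal for $F(\cdot,Q)$ if $F(\gamma,Q)=\inf\{F(\omega,Q):\omega\in\Gamma,\ \omega(0)=\gamma(0)\}$. The measure $Q$ is an equilibrium if the image of $Q$ under $\gamma\mapsto\gamma(0)$ is $m_0$, $\int_\Gamma F(\gamma,Q)\,dQ(\gamma)<\infty$, and every $\gamma\in\operatorname{spt}(Q)$ is optimal for $F(\cdot,Q)$. Given $Q$, let $$a(t,x)=\int\eta(x-\omega(t))\,dQ(\omega),\quad u(t,x)=\frac1{a(t,x)}\int\omega'(t)\,\eta(x-\omega(t))\,dQ(\omega),\quad \sigma(t,x)=\int|\omega'(t)-u(t,x)|^2\eta(x-\omega(t))\,dQ(\omega),$$ where $u$ and $\sigma$ are defined for a.e. $t$. The Euler–Lagrange momentum of a curve $\gamma$ is the absolutely continuous function $z_\gamma:[0,T]\to\mathbb R^d$ with the following properties: * $z_\gamma=\delta\gamma'+\lambda a(t,\gamma)(\gamma'-u(t,\gamma))$ for a.e. $t$; * $z_\gamma'=\frac\lambda2\big[|\gamma'-u|^2\nabla_xa+2a\,(\nabla_xu)^{\mathsf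 T}(u-\gamma')+\nabla_x\sigma\big](t,\gamma(t))$ for a.e. $t$ such that $a(t,\cdot),u(t,\cdot),\sigma(t,\cdot)$ are differentiable at $\gamma(t)$; * $z_\gamma(T)=-\nabla\Psi(\gamma(T))$ if $\Psi$ is differentiable at $\gamma(T)$. Let $Q$ be an equilibrium. Then every curve $\gamma$ which is optimal for $F(\cdot,Q)$ has a momentum $z_\gamma$, the number $$\|z\|_\infty:=\sup\{|z_\gamma(t)|\;:\;\gamma\text{ optimal for }F(\cdot,Q),\ t\in[0,T]\}$$ is finite, and every curve $\gamma\in\operatorname{spt}(Q)$ is Lipschitz continuous on $[0,T]$ with a Lipschitz constant at most $\|z\|_\infty/\delta$. -/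

import Mathlib

open MeasureTheory Set
open scoped ENNReal NNReal

noncomputable section

/-- The Euclidean space `ℝ^d`. -/
abbrev Euc (d : ℕ) : Type := EuclideanSpace ℝ (Fin d)

/-- The lattice `ℤ^d` in `ℝ^d`. -/
def integerLattice (d : ℕ) : AddSubgroup (Euc d) where
  carrier := {x | ∀ i, ∃ n : ℤ, x i = n}
  zero_mem' := fun _ => ⟨0, by simp⟩
  add_mem' := by
    intro x y hx hy i
    obtain ⟨m, hm⟩ := hx i
    obtain ⟨n, hn⟩ := hy i
    exact ⟨m + n, by simp [hm, hn]⟩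
  neg_mem' := by
    intro x hx i
    obtain ⟨m, hm⟩ := hx i
    exact ⟨-m, by simp [hm]⟩

/-- The lattices whose quotient is one of the two domains without boundary: `ℝ^d / {0}`, which is
the whole space, and `ℝ^d / ℤ^d`, which is the flat torus. -/
def IsSpaceOrTorusLattice {d : ℕ} (Λ : AddSubgroup (Euc d)) : Prop :=
  Λ = ⊥ ∨ Λ = integerLattice d

/-- The domain `Ω = ℝ^d / Λ`; Mathlib's quotient norm makes its distance
the flat distance `|x - y| = inf {|v| : v ∈ ℝ^d is a representative of x - y}`. -/
abbrev Dom {d : ℕ} (Λ : AddSubgroup (Euc d)) : Type := Euc d ⧸ Λ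

/-- The point of the domain represented by a vector. -/
def toDom {d : ℕ} (Λ : AddSubgroup (Euc d)) (v : Euc d) : Dom Λ := (v : Euc d ⧸ Λ)

/-- The space `Γ` of continuous curves `[0,T] → Ω` with the topology of uniform convergence. -/
abbrev Curve {d : ℕ} (Λ : AddSubgroup (Euc d)) (T : ℝ) : Type := C(Icc (0 : ℝ) T, Dom Λ)

/-- Probability measures on curves are Borel measures. -/
instance Curve.instMeasurableSpace {d : ℕ} (Λ : AddSubgroup (Euc d)) (T : ℝ) :
    MeasurableSpace (Curve Λ T) := borel _

instance Curve.instBorelSpace {d : ℕ} (Λ : AddSubgroup (Euc d)) (T : ℝ) :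
    BorelSpace (Curve Λ T) := ⟨rfl⟩

/-- The function `f` read in the flat chart `h ↦ x + h` centred at `x`; the spatial derivatives of
`f` at `x` are the derivatives at `0` of this function. -/
def inChart {d : ℕ} {Λ : AddSubgroup (Euc d)} {F : Type*} (f : Dom Λ → F) (x : Dom Λ) :
    Euc d → F := fun h => f (x + toDom Λ h)

/-- `f` is differentiable at the point `x` of the domain. -/
def DiffAt {d : ℕ} {Λ : AddSubgroup (Euc d)} {F : Type*} [NormedAddCommGroup F] [NormedSpace ℝ F]
    (f : Dom Λ → F) (x : Dom Λ) : Prop := DifferentiableAt ℝ (inChart f x) 0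

/-- The gradient `∇f(x) ∈ ℝ^d` of a real function on the domain. -/
def grad {d : ℕ} {Λ : AddSubgroup (Euc d)} (f : Dom Λ → ℝ) (x : Dom Λ) : Euc d :=
  gradient (inChart f x) 0

/-- The Jacobian `∇f(x)` of a vector field on the domain, as a linear map. -/
def jacobian {d : ℕ} {Λ : AddSubgroup (Euc d)} (f : Dom Λ → Euc d) (x : Dom Λ) :
    Euc d →L[ℝ] Euc d := fderiv ℝ (inChart f x) 0

/-- Lebesgue measure on `[0,T]`. -/
def timeMeasure (T : ℝ) : Measure (Icc (0 : ℝ) T) := volume.comap Subtype.val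

section Velocity

variable {d : ℕ} {Λ : AddSubgroup (Euc d)} {T : ℝ}

/-- `γ'(t) = v`: some lift of `γ` to `ℝ^d` has the derivative `v` at `t` (one-sided at the
endpoints of `[0,T]`). -/
def HasVelocityAt (γ : Curve Λ T) (v : Euc d) (t : Icc (0 : ℝ) T) : Prop :=
  ∃ w : ℝ → Euc d, (∀ s : Icc (0 : ℝ) T, toDom Λ (w s) = γ s) ∧
    HasDerivWithinAt w v (Icc 0 T) t

open Classical in
/-- The velocity `γ'(t)`, with the value `0` where `γ` is not differentiable. -/
def velocity (γ : Curve Λ T) (t : Icc (0 : ℝ) T) : Euc d :=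
  if h : ∃ v, HasVelocityAt γ v t then h.choose else 0

/-- `γ ∈ H¹([0,T])`: `γ` is a primitive of a square integrable function. -/
def IsH1 (γ : Curve Λ T) : Prop :=
  ∃ g : ℝ → Euc d, MemLp g 2 (volume.restrict (Icc 0 T)) ∧
    ∀ s t : Icc (0 : ℝ) T, γ t = γ s + toDom Λ (∫ r in (s : ℝ)..t, g r)

open Classical in
/-- The kinetic energy `K(γ) = ½ ∫₀ᵀ |γ'|² dt`, infinite outside `H¹`. -/
def kinetic (γ : Curve Λ T) : ℝ≥0∞ :=
  if IsH1 γ then 2⁻¹ * ∫⁻ t : Icc (0 : ℝ) T, ‖velocity γ t‖ₑ ^ 2 ∂timeMeasure T else ⊤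

open Classical in
/-- The interaction cost `V(γ,ω) = ½ ∫₀ᵀ |γ' - ω'|² η(γ - ω) dt`, infinite if `γ - ω ∉ H¹`. -/
def interaction (η : Dom Λ → ℝ) (γ ω : Curve Λ T) : ℝ≥0∞ :=
  if IsH1 (γ - ω) then
    2⁻¹ * ∫⁻ t : Icc (0 : ℝ) T, ‖velocity (γ - ω) t‖ₑ ^ 2 * ENNReal.ofReal (η (γ t - ω t))
      ∂timeMeasure T
  else ⊤

end Velocity

/-- The data of the game on `Ω = ℝ^d / Λ`, with the standing assumptions on them. -/
structure Game {d : ℕ} (Λ : AddSubgroup (Euc d)) where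
  /-- the time horizon -/
  T : ℝ
  T_pos : 0 < T
  /-- the weight of the kinetic energy -/
  δ : ℝ
  δ_pos : 0 < δ
  /-- the weight `λ` of the interaction -/
  lam : ℝ
  lam_pos : 0 < lam
  /-- the final cost -/
  Ψ : Dom Λ → ℝ
  Ψ_cont : Continuous Ψ
  Ψ_bdd_or_lip : (∃ C, ∀ x, |Ψ x| ≤ C) ∨ ∃ C : ℝ≥0, LipschitzWith C Ψ
  /-- the interaction kernel (a `ℤ^d`-periodic function of `ℝ^d` in the case of the torus) -/
  η : Dom Λ → ℝ
  η_cont : Continuous η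
  η_nonneg : ∀ x, 0 ≤ η x
  η_bdd : ∃ C, ∀ x, η x ≤ C
  /-- the initial distribution of the players -/
  m₀ : Measure (Dom Λ)
  m₀_prob : IsProbabilityMeasure m₀

namespace Game

variable {d : ℕ} {Λ : AddSubgroup (Euc d)} (G : Game Λ)

/-- The space of curves of the game. -/
abbrev Path : Type := Curve Λ G.T

/-- The time `0` as an element of `[0,T]`. -/
def t₀ : Icc (0 : ℝ) G.T := ⟨0, le_rfl, G.T_pos.le⟩

/-- The time `T` as an element of `[0,T]`. -/
def t₁ : Icc (0 : ℝ) G.T := ⟨G.T, G.T_pos.le, le_rfl⟩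

/-- `V_Q(γ) = ∫ V(γ,ω) dQ(ω)`. -/
def meanInteraction (Q : Measure G.Path) (γ : G.Path) : ℝ≥0∞ :=
  ∫⁻ ω, interaction G.η γ ω ∂Q

/-- The cost `F(γ,Q) = δ K(γ) + Ψ(γ(T)) + λ V_Q(γ) ∈ (-∞,+∞]` of the curve `γ`. -/
def cost (γ : G.Path) (Q : Measure G.Path) : EReal :=
  ((ENNReal.ofReal G.δ * kinetic γ + ENNReal.ofReal G.lam * G.meanInteraction Q γ : ℝ≥0∞) : EReal)
    + (G.Ψ (γ G.t₁) : EReal)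

/-- `γ` is optimal for `F(·,Q)` among the curves with the same initial point. -/
def IsOptimal (γ : G.Path) (Q : Measure G.Path) : Prop :=
  G.cost γ Q = ⨅ (ω : G.Path) (_ : ω G.t₀ = γ G.t₀), G.cost ω Q

/-- Lagrangian equilibria of the game. In `finite_cost`, `EReal.toENNReal` is the positive part, so
that the condition is `∫ F(γ,Q)⁺ dQ(γ) < ∞`, i.e. `∫ F(γ,Q) dQ(γ) < ∞` as soon as the negative part
of `F(·,Q)` is integrable. -/
structure IsEquilibrium (Q : Measure G.Path) : Prop where
  prob : IsProbabilityMeasure Q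
  initial : Q.map (fun γ => γ G.t₀) = G.m₀
  finite_cost : ∫⁻ γ, (G.cost γ Q).toENNReal ∂Q < ⊤
  optimal : ∀ γ ∈ Q.support, G.IsOptimal γ Q

/-- `a(t,x) = ∫ η(x - ω(t)) dQ(ω)`. -/
def a (Q : Measure G.Path) (t : Icc (0 : ℝ) G.T) (x : Dom Λ) : ℝ :=
  ∫ ω : G.Path, G.η (x - ω t) ∂Q

/-- `u(t,x) = a(t,x)⁻¹ ∫ η(x - ω(t)) ω'(t) dQ(ω)`. -/
def u (Q : Measure G.Path) (t : Icc (0 : ℝ) G.T) (x : Dom Λ) : Euc d :=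
  (G.a Q t x)⁻¹ • ∫ ω : G.Path, G.η (x - ω t) • velocity ω t ∂Q

/-- `σ(t,x) = ∫ |ω'(t) - u(t,x)|² η(x - ω(t)) dQ(ω)`. -/
def sigma (Q : Measure G.Path) (t : Icc (0 : ℝ) G.T) (x : Dom Λ) : ℝ :=
  ∫ ω : G.Path, ‖velocity ω t - G.u Q t x‖ ^ 2 * G.η (x - ω t) ∂Q

/-- The gradient with respect to `x` of `(λ/2) (a(t,x) |v - u(t,x)|² + σ(t,x))`:
`(λ/2) (|v - u|² ∇a + 2 a (∇u)ᵀ (u - v) + ∇σ)`. -/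
def force (Q : Measure G.Path) (t : Icc (0 : ℝ) G.T) (x : Dom Λ) (v : Euc d) : Euc d :=
  (G.lam / 2) • (‖v - G.u Q t x‖ ^ 2 • grad (G.a Q t) x
    + (2 * G.a Q t x) • (jacobian (G.u Q t) x).adjoint (G.u Q t x - v)
    + grad (G.sigma Q t) x)

/-- `z = z_γ` is the Euler–Lagrange momentum of the curve `γ`: the absolutely continuous function
which coincides a.e. with `δ γ' + λ a (γ' - u)`, and which satisfies the Euler–Lagrange equation and
the transversality condition wherever the derivatives in them exist (`η` and `Ψ` being only
Lipschitz continuous). -/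
structure IsMomentum (Q : Measure G.Path) (γ : G.Path) (z : ℝ → Euc d) : Prop where
  absCont : AbsolutelyContinuousOnInterval z 0 G.T
  eq_momentum : ∀ᵐ t : Icc (0 : ℝ) G.T ∂timeMeasure G.T,
    z t = G.δ • velocity γ t + (G.lam * G.a Q t (γ t)) • (velocity γ t - G.u Q t (γ t))
  eulerLagrange : ∀ᵐ t : Icc (0 : ℝ) G.T ∂timeMeasure G.T,
    DiffAt (G.a Q t) (γ t) → DiffAt (G.u Q t) (γ t) → DiffAt (G.sigma Q t) (γ t) →
      HasDerivAt z (G.force Q t (γ t) (velocity γ t)) t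
  final : DiffAt G.Ψ (γ G.t₁) → z G.T = -grad G.Ψ (γ G.t₁)

/-- `‖z‖_∞`: the least uniform bound on the momenta of all the optimal curves. -/
def momentumBound (Q : Measure G.Path) : ℝ≥0∞ :=
  ⨆ (γ : G.Path) (_ : G.IsOptimal γ Q) (z : ℝ → Euc d) (_ : G.IsMomentum Q γ z)
    (t : Icc (0 : ℝ) G.T), ‖z t‖ₑ

end Game

end

/-! The gradient bound on `η` integrates along segments to `η(x+v) ≤ exp(C|v|) η(x)`. Averaging over
the players gives the same relative control for the interaction density `ℓ(r,x,v) = ½ ∫ |v - ω'(r)|²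
η(x - ω(r)) dQ(ω)`: moving `x` by `h` changes `ℓ` by at most `(exp(C|h|) - 1) ℓ`. Along an optimal
curve `ℓ` is integrable in time, so position variations are controlled by the interaction cost
itself. In `v` the density is quadratic: `ℓ = ½ (a |v - u|² + σ)`, with gradient `a (v - u)`.

Comparing an optimal `γ` with `γ + εφ` yields a first variation inequality for `p = δγ' + λa(γ' -
u)` (`firstVariation`). Since `η` is only Lipschitz, the position part enters through difference
quotients, which need not converge but are dominated by an integrable `k`, a multiple of `ℓ`.
Trapezoidal test functions shrinking to Lebesgue points of `p` give `|p(t) - p(s)| ≤ ∫ k` over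
`[s,t]`; hence `p` is a Lipschitz function of the primitive of `k` and has an absolutely continuous
representative `z` (`exists_continuous_ae_eq`). Replacing `k` by suprema of the quotients identifies
`z'` wherever they converge (`ae_hasDerivAt`), and ramps ending at `T` give the transversality
condition and `|z| ≤ L + ∫ k`, where `L` is a Lipschitz constant of `Ψ`.

The last bound is uniform in `γ`: `∫ k` is a multiple of the interaction cost of `γ`, and comparison
with the curve that rests at `γ(0)` bounds this cost through the mean kinetic energy of the players,
which is finite at equilibrium (`lintegral_kinetic_lt_top`, `optimal_bound`).

For the speeds, `(δ + λa) γ' = z + λ a u`, where `u` is a weighted mean of the players' velocities.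
If the essential supremum `M` of the players' speeds at a given time were known to be finite, then
`(δ + λa) M ≤ ‖z‖ + λaM` would give `M ≤ ‖z‖/δ`. A crude bound from the first moment of the speeds
starts an iteration in which the excess over `‖z‖/δ` contracts by the factor `λB/(δ + λB) < 1`, with
`B` a bound of `η` (`ae_norm_vel_le`). -/

open Filter Topology

/-! ### Local inversion of the quotient map. -/

section Lattice

variable {d : ℕ} {Λ : AddSubgroup (Euc d)} {ρ : ℝ}

/-- Nonzero elements of the subgroup `Λ` have norm at least `ρ`. -/
def IsSeparated (Λ : AddSubgroup (Euc d)) (ρ : ℝ) : Prop :=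
  0 < ρ ∧ ∀ v ∈ Λ, ‖v‖ < ρ → v = 0

theorem IsSpaceOrTorusLattice.exists_isSeparated (h : IsSpaceOrTorusLattice Λ) :
    ∃ ρ, IsSeparated Λ ρ := by
  refine ⟨1, one_pos, fun v hv h1 => ?_⟩
  rcases h with rfl | rfl
  · simpa using hv
  · ext i
    obtain ⟨n, hn⟩ := hv i
    have h2 : |v i| < 1 := (by simpa using PiLp.norm_apply_le v i : |v i| ≤ ‖v‖).trans_lt h1
    rw [hn] at h2
    rw [← Int.cast_abs, ← Int.cast_one, Int.cast_lt] at h2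
    have : n = 0 := Int.abs_lt_one_iff.1 h2
    simp [hn, this]

/-- Separation makes the subgroup discrete. Closedness is what makes the quotient Hausdorff and its
σ-algebra the Borel one. -/
theorem IsSeparated.isClosed (h : IsSeparated Λ ρ) : IsClosed (Λ : Set (Euc d)) := by
  have : DiscreteTopology Λ := by
    rw [discreteTopology_iff_isOpen_singleton_zero, Metric.isOpen_singleton_iff]
    refine ⟨ρ, h.1, fun y hy => ?_⟩
    have := h.2 y y.2 (by simpa [dist_eq_norm] using hy)
    exact Subtype.ext this
  exact AddSubgroup.isClosed_of_discrete

theorem continuous_toDom : Continuous (toDom Λ) := continuous_quotient_mk'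

@[simp] theorem toDom_zero : toDom Λ 0 = 0 := rfl
theorem toDom_add (v w : Euc d) : toDom Λ (v + w) = toDom Λ v + toDom Λ w := rfl
theorem toDom_sub (v w : Euc d) : toDom Λ (v - w) = toDom Λ v - toDom Λ w := rfl
theorem toDom_neg (v : Euc d) : toDom Λ (-v) = -toDom Λ v := rfl

theorem exists_toDom_eq (x : Dom Λ) : ∃ v, toDom Λ v = x := QuotientAddGroup.mk_surjective x

theorem toDom_eq_zero {v : Euc d} : toDom Λ v = 0 ↔ v ∈ Λ := QuotientAddGroup.eq_zero_iff v

theorem norm_toDom_le (v : Euc d) : ‖toDom Λ v‖ ≤ ‖v‖ := QuotientAddGroup.norm_mk_le_norm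

theorem exists_toDom_eq_norm_lt {x : Dom Λ} {c : ℝ} (h : ‖x‖ < c) :
    ∃ v, toDom Λ v = x ∧ ‖v‖ < c := QuotientAddGroup.norm_lt_iff.1 h

/-- A strictly shorter representative would differ from `v` by a lattice vector shorter than `ρ`,
that is, by zero. -/
theorem IsSeparated.norm_toDom (h : IsSeparated Λ ρ) {v : Euc d} (hv : ‖v‖ ≤ ρ / 2) :
    ‖toDom Λ v‖ = ‖v‖ := by
  refine le_antisymm (norm_toDom_le v) (le_of_not_gt fun hlt => ?_)
  obtain ⟨w, hw, hwv⟩ := exists_toDom_eq_norm_lt hlt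
  have h0 : w - v = 0 := by
    refine h.2 _ (toDom_eq_zero.1 (by rw [toDom_sub, hw, sub_self])) ?_
    linarith [norm_sub_le w v]
  rw [sub_eq_zero.1 h0] at hwv
  exact lt_irrefl _ hwv

open Classical in
/-- The inverse of the chart `toDom` near the origin. -/
noncomputable def localLift (Λ : AddSubgroup (Euc d)) (ρ : ℝ) (x : Dom Λ) : Euc d :=
  if h : ∃ v, toDom Λ v = x ∧ ‖v‖ < ρ / 4 then h.choose else 0

theorem toDom_localLift {x : Dom Λ} (hx : ‖x‖ < ρ / 4) :
    toDom Λ (localLift Λ ρ x) = x ∧ ‖localLift Λ ρ x‖ < ρ / 4 := by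
  have h := exists_toDom_eq_norm_lt hx
  rw [localLift, dif_pos h]
  exact h.choose_spec

theorem IsSeparated.localLift_toDom (h : IsSeparated Λ ρ) {v : Euc d} (hv : ‖v‖ < ρ / 4) :
    localLift Λ ρ (toDom Λ v) = v := by
  obtain ⟨h1, h2⟩ := toDom_localLift ((norm_toDom_le (Λ := Λ) v).trans_lt hv)
  refine sub_eq_zero.1 (h.2 _ (toDom_eq_zero.1 (by rw [toDom_sub, h1, sub_self])) ?_)
  linarith [norm_sub_le (localLift Λ ρ (toDom Λ v)) v, h.1]

theorem IsSeparated.norm_localLift_sub (h : IsSeparated Λ ρ) {x y : Dom Λ}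
    (hx : ‖x‖ < ρ / 4) (hy : ‖y‖ < ρ / 4) :
    ‖localLift Λ ρ x - localLift Λ ρ y‖ = ‖x - y‖ := by
  obtain ⟨h1, h2⟩ := toDom_localLift hx
  obtain ⟨h3, h4⟩ := toDom_localLift hy
  rw [← h.norm_toDom (v := _ - _), toDom_sub, h1, h3]
  linarith [norm_sub_le (localLift Λ ρ x) (localLift Λ ρ y)]

/-- A continuous function on the domain which is the inverse of `toDom` near the origin. -/
noncomputable def cutLift (Λ : AddSubgroup (Euc d)) (ρ : ℝ) (x : Dom Λ) : Euc d :=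
  max 0 (min 1 (2 - 16 * ‖x‖ / ρ)) • localLift Λ ρ x

theorem IsSeparated.cutLift_eq (h : IsSeparated Λ ρ) {x : Dom Λ} (hx : ‖x‖ < ρ / 16) :
    cutLift Λ ρ x = localLift Λ ρ x := by
  have h1 : 16 * ‖x‖ / ρ ≤ 1 := by rw [div_le_one h.1]; linarith
  rw [cutLift, min_eq_left (by linarith), max_eq_right zero_le_one, one_smul]

theorem IsSeparated.cutLift_toDom (h : IsSeparated Λ ρ) {v : Euc d} (hv : ‖v‖ < ρ / 16) :
    cutLift Λ ρ (toDom Λ v) = v := by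
  rw [h.cutLift_eq ((norm_toDom_le v).trans_lt hv), h.localLift_toDom (by linarith [h.1])]

theorem IsSeparated.toDom_cutLift (h : IsSeparated Λ ρ) {x : Dom Λ} (hx : ‖x‖ < ρ / 16) :
    toDom Λ (cutLift Λ ρ x) = x := by
  rw [h.cutLift_eq hx, (toDom_localLift (by linarith [h.1])).1]

/-- On the ball of radius `ρ/4` the local lift is an isometry. The cutoff factor vanishes from norm
`ρ/8` on, so the junk values of the lift beyond `ρ/4` never show. -/
theorem IsSeparated.continuous_cutLift (h : IsSeparated Λ ρ) : Continuous (cutLift Λ ρ) := by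
  rw [continuous_iff_continuousAt]
  intro x
  rcases lt_or_ge ‖x‖ (ρ / 4) with hx | hx
  · have h1 : ContinuousAt (localLift Λ ρ) x := by
      rw [Metric.continuousAt_iff]
      intro ε hε
      refine ⟨min ε (ρ / 4 - ‖x‖), lt_min hε (by linarith), fun {y} hy => ?_⟩
      rw [dist_eq_norm] at hy
      have hy1 := hy.trans_le (min_le_left _ _)
      have hy2 := hy.trans_le (min_le_right _ _)
      have : ‖y‖ ≤ ‖y - x‖ + ‖x‖ := by simpa using norm_add_le (y - x) x
      rw [dist_eq_norm, h.norm_localLift_sub (by linarith) hx]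
      exact hy1
    have h2 : Continuous fun y : Dom Λ => max 0 (min 1 (2 - 16 * ‖y‖ / ρ)) :=
      continuous_const.max (continuous_const.min (continuous_const.sub
        ((continuous_const.mul continuous_norm).div_const _)))
    exact h2.continuousAt.smul h1
  · have h1 : cutLift Λ ρ =ᶠ[𝓝 x] fun _ => 0 := by
      have : ∀ᶠ y : Dom Λ in 𝓝 x, ρ / 8 < ‖y‖ :=
        continuous_norm.continuousAt.eventually (lt_mem_nhds (by linarith [h.1]))
      filter_upwards [this] with y hy
      have h2 : 2 ≤ 16 * ‖y‖ / ρ := by rw [le_div_iff₀ h.1]; linarith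
      rw [cutLift, max_eq_left (min_le_of_right_le (by linarith)), zero_smul]
    exact continuousAt_const.congr h1.symm

end Lattice

/-! ### Velocities of curves and their joint measurability. -/

section Velocity

variable {d : ℕ} {Λ : AddSubgroup (Euc d)} {ρ T : ℝ}

/-- The displacement `γ(r) - γ(t)` read in the flat chart for `r` near `t`. -/
noncomputable def displacement (ρ : ℝ) (hT : 0 ≤ T) (γ : Curve Λ T) (t : Icc (0 : ℝ) T) (r : ℝ) :
    Euc d := cutLift Λ ρ (γ (projIcc 0 T hT r) - γ t)

/-- Replaces the existential over lifts by one canonical function of the curve and the time. A lift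
differentiable at `t` is continuous there, so its increments near `t` are short and agree with those
read in the chart. -/
theorem IsSeparated.hasVelocityAt_iff (h : IsSeparated Λ ρ) (hT : 0 ≤ T) {γ : Curve Λ T} {v : Euc d}
    {t : Icc (0 : ℝ) T} :
    HasVelocityAt γ v t ↔ HasDerivWithinAt (displacement ρ hT γ t) v (Icc 0 T) t := by
  have hpos : 0 < ρ / 16 := by linarith [h.1]
  constructor
  · rintro ⟨w, hw, hd⟩
    have h1 : HasDerivWithinAt (fun r => w r - w t) v (Icc 0 T) t := hd.sub_const _
    refine h1.congr_of_eventuallyEq ?_ (by simp [displacement, ← toDom_zero, h.cutLift_toDom, hpos])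
    have h2 : Tendsto (fun r => w r - w t) (𝓝[Icc 0 T] (t : ℝ)) (𝓝 0) := by
      simpa using h1.continuousWithinAt.tendsto
    have h3 := h2.norm
    rw [norm_zero] at h3
    filter_upwards [h3.eventually (gt_mem_nhds hpos), self_mem_nhdsWithin] with r hr hr'
    rw [displacement, projIcc_of_mem hT hr', ← hw ⟨r, hr'⟩, ← hw t, ← toDom_sub, h.cutLift_toDom hr]
  · intro hd
    obtain ⟨v₀, hv₀⟩ := exists_toDom_eq (γ t)
    have hc : Continuous fun r => γ (projIcc 0 T hT r) - γ t :=
      (γ.continuous.comp continuous_projIcc).sub continuous_const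
    have he : ∀ᶠ r in 𝓝[Icc 0 T] (t : ℝ), ‖γ (projIcc 0 T hT r) - γ t‖ < ρ / 16 := by
      have : Tendsto (fun r => ‖γ (projIcc 0 T hT r) - γ t‖) (𝓝[Icc 0 T] (t : ℝ)) (𝓝 0) := by
        have := (hc.norm.tendsto (t : ℝ)).mono_left (nhdsWithin_le_nhds (s := Icc 0 T))
        simpa using this
      exact this.eventually (gt_mem_nhds hpos)
    classical
    -- Only the behaviour near `t` matters for the derivative, so elsewhere arbitrary
    -- representatives are chosen, without any continuity.
    let w : ℝ → Euc d := fun r => if ‖γ (projIcc 0 T hT r) - γ t‖ < ρ / 16 then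
      v₀ + displacement ρ hT γ t r else (exists_toDom_eq (γ (projIcc 0 T hT r))).choose
    refine ⟨w, fun s => ?_, ?_⟩
    · by_cases hs : ‖γ (projIcc 0 T hT s) - γ t‖ < ρ / 16
      · simp only [w, if_pos hs, toDom_add, hv₀, displacement, h.toDom_cutLift hs]
        simp
      · simp only [w, if_neg hs, (exists_toDom_eq (γ (projIcc 0 T hT s))).choose_spec]
        simp
    · refine (hd.const_add v₀).congr_of_eventuallyEq ?_ ?_
      · filter_upwards [he] with r hr
        simp only [w, if_pos hr]
      · simp only [w]
        rw [if_pos (by simpa using hpos)]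

theorem IsSeparated.hasVelocityAt_unique (h : IsSeparated Λ ρ) (hT : 0 < T) {γ : Curve Λ T}
    {v w : Euc d} {t : Icc (0 : ℝ) T} (hv : HasVelocityAt γ v t) (hw : HasVelocityAt γ w t) :
    v = w :=
  (uniqueDiffOn_Icc hT t t.2).eq_deriv _ ((h.hasVelocityAt_iff hT.le).1 hv)
    ((h.hasVelocityAt_iff hT.le).1 hw)

theorem IsSeparated.velocity_eq (h : IsSeparated Λ ρ) (hT : 0 < T) {γ : Curve Λ T}
    {v : Euc d} {t : Icc (0 : ℝ) T} (hv : HasVelocityAt γ v t) : velocity γ t = v := by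
  have h1 : ∃ v, HasVelocityAt γ v t := ⟨v, hv⟩
  rw [velocity, dif_pos h1]
  exact h.hasVelocityAt_unique hT h1.choose_spec hv

theorem IsSeparated.velocity_eq_deriv (h : IsSeparated Λ ρ) (hT : 0 < T) (γ : Curve Λ T)
    {t : Icc (0 : ℝ) T} (ht : (t : ℝ) ∈ Ioo 0 T) :
    velocity γ t = deriv (displacement ρ hT.le γ t) t := by
  have hn : Icc 0 T ∈ 𝓝 (t : ℝ) := Icc_mem_nhds ht.1 ht.2
  by_cases hv : ∃ v, HasVelocityAt γ v t
  · obtain ⟨v, hv⟩ := hv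
    rw [h.velocity_eq hT hv]
    exact (((h.hasVelocityAt_iff hT.le).1 hv).hasDerivAt hn).deriv.symm
  · rw [velocity, dif_neg hv, deriv_zero_of_not_differentiableAt]
    exact fun hd => hv ⟨_, (h.hasVelocityAt_iff hT.le).2 hd.hasDerivAt.hasDerivWithinAt⟩

/-- The velocity of a curve, modified at the end points of the time interval in order to be
measurable with respect to the curve and the time. -/
noncomputable def velocity' (ρ : ℝ) (hT : 0 ≤ T) (γ : Curve Λ T) (r : ℝ) : Euc d :=
  deriv (displacement ρ hT γ (projIcc 0 T hT r)) r

theorem IsSeparated.velocity'_eq (h : IsSeparated Λ ρ) (hT : 0 < T) (γ : Curve Λ T)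
    {t : Icc (0 : ℝ) T} (ht : (t : ℝ) ∈ Ioo 0 T) : velocity' ρ hT.le γ t = velocity γ t := by
  rw [h.velocity_eq_deriv hT γ ht, velocity', projIcc_val]

theorem continuous_curve_eval : Continuous fun p : Curve Λ T × Icc (0 : ℝ) T => p.1 p.2 :=
  ContinuousEval.continuous_eval

instance : SecondCountableTopology (Dom Λ) := inferInstance

instance : SecondCountableTopology (Curve Λ T) := inferInstance

/-- The displacement is jointly continuous in the curve, the base time and `r`, so its derivative in
`r` is jointly measurable; the base time is then set equal to the projection of `r`. This is what
permits Fubini over players and times. -/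
theorem IsSeparated.measurable_velocity' (h : IsSeparated Λ ρ) (hT : 0 ≤ T) :
    Measurable fun p : Curve Λ T × ℝ => velocity' ρ hT p.1 p.2 := by
  have := h.isClosed
  have hf : Continuous (Function.uncurry fun (p : Curve Λ T × Icc (0 : ℝ) T) (r : ℝ) =>
      displacement ρ hT p.1 p.2 r) := by
    refine h.continuous_cutLift.comp ?_
    have h1 : Continuous fun q : (Curve Λ T × Icc (0 : ℝ) T) × ℝ => q.1.1 (projIcc 0 T hT q.2) :=
      continuous_curve_eval.comp
        ((continuous_fst.comp continuous_fst).prodMk ((continuous_projIcc (h := hT)).comp continuous_snd))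
    have h2 : Continuous fun q : (Curve Λ T × Icc (0 : ℝ) T) × ℝ => q.1.1 q.1.2 :=
      continuous_curve_eval.comp continuous_fst
    exact h1.sub h2
  have h2 : Measurable fun p : Curve Λ T × ℝ => ((p.1, projIcc 0 T hT p.2), p.2) :=
    (measurable_fst.prodMk (continuous_projIcc.measurable.comp measurable_snd)).prodMk
      measurable_snd
  have h3 := measurable_deriv_with_param hf
  have h4 := h3.comp h2
  exact h4

end Velocity

/-! ### Weak derivatives and the costs as integrals over time. -/

section SobolevCurves

variable {d : ℕ} {Λ : AddSubgroup (Euc d)} {ρ T : ℝ}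

theorem timeMeasure_map :
    (timeMeasure T).map Subtype.val = volume.restrict (Ioc 0 T) := by
  rw [timeMeasure, (MeasurableEmbedding.subtype_coe measurableSet_Icc).map_comap,
    Subtype.range_coe, Measure.restrict_congr_set Ioc_ae_eq_Icc]

theorem lintegral_timeMeasure (hT : 0 ≤ T) (f : Icc (0 : ℝ) T → ℝ≥0∞) :
    ∫⁻ t, f t ∂timeMeasure T = ∫⁻ r in Ioc 0 T, f (projIcc 0 T hT r) := by
  rw [← timeMeasure_map, (MeasurableEmbedding.subtype_coe measurableSet_Icc).lintegral_map]
  simp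

theorem ae_timeMeasure_iff (hT : 0 ≤ T) (p : Icc (0 : ℝ) T → Prop) :
    (∀ᵐ t ∂timeMeasure T, p t) ↔ ∀ᵐ r ∂volume.restrict (Ioc 0 T), p (projIcc 0 T hT r) := by
  rw [← timeMeasure_map, (MeasurableEmbedding.subtype_coe measurableSet_Icc).ae_map_iff]
  simp

theorem ae_restrict_Ioo_mem : ∀ᵐ r ∂volume.restrict (Ioc 0 T), r ∈ Ioo 0 T := by
  rw [← Measure.restrict_congr_set Ioo_ae_eq_Ioc]
  exact ae_restrict_mem measurableSet_Ioo

theorem IsSeparated.ae_velocity'_eq (h : IsSeparated Λ ρ) (hT : 0 < T) (γ : Curve Λ T) :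
    ∀ᵐ r ∂volume.restrict (Ioc 0 T), velocity γ (projIcc 0 T hT.le r) = velocity' ρ hT.le γ r := by
  filter_upwards [ae_restrict_Ioo_mem] with r hr
  have h1 := h.velocity'_eq hT γ (t := ⟨r, Ioo_subset_Icc_self hr⟩) hr
  rw [projIcc_of_mem hT.le (Ioo_subset_Icc_self hr), ← h1]

theorem intervalIntegrable_of_memLp_two {g : ℝ → Euc d}
    (hg : MemLp g 2 (volume.restrict (Ioc 0 T))) {s t : ℝ} (hs : s ∈ Icc 0 T) (ht : t ∈ Icc 0 T) :
    IntervalIntegrable g volume s t := by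
  have h1 : IntegrableOn g (Ioc 0 T) := hg.integrable one_le_two
  have h2 : IntervalIntegrable g volume 0 T :=
    (intervalIntegrable_iff_integrableOn_Ioc_of_le (hs.1.trans hs.2)).2 h1
  exact h2.mono_set (by
    rw [uIcc_of_le (hs.1.trans hs.2)]
    exact uIcc_subset_Icc hs ht)

/-- `g` is a square integrable weak derivative of the curve `γ`. -/
def IsWeakDeriv (γ : Curve Λ T) (g : ℝ → Euc d) : Prop :=
  MemLp g 2 (volume.restrict (Ioc 0 T)) ∧
    ∀ s t : Icc (0 : ℝ) T, γ t = γ s + toDom Λ (∫ r in (s : ℝ)..t, g r)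

theorem isH1_iff {γ : Curve Λ T} : IsH1 γ ↔ ∃ g, IsWeakDeriv γ g := by
  simp only [IsH1, IsWeakDeriv, Measure.restrict_congr_set (Ioc_ae_eq_Icc (μ := volume))]

/-- The primitive of `g`, started at a representative of `γ(0)`, is a lift of `γ`, and Lebesgue
differentiation gives it the derivative `g` almost everywhere. -/
theorem IsWeakDeriv.ae_eq (h : IsSeparated Λ ρ) (hT : 0 < T) {γ : Curve Λ T} {g : ℝ → Euc d}
    (hg : IsWeakDeriv γ g) : velocity' ρ hT.le γ =ᵐ[volume.restrict (Ioc 0 T)] g := by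
  have hi := intervalIntegrable_of_memLp_two hg.1 (left_mem_Icc.2 hT.le) (right_mem_Icc.2 hT.le)
  have h1 := (ae_restrict_of_ae (s := Ioc 0 T) hi.ae_hasDerivAt_integral)
  filter_upwards [h1, ae_restrict_Ioo_mem, h.ae_velocity'_eq hT γ] with r hr1 hr hv
  have hrI := Ioo_subset_Icc_self hr
  rw [← hv]
  refine h.velocity_eq hT ?_
  obtain ⟨v₀, hv₀⟩ := exists_toDom_eq (γ ⟨0, left_mem_Icc.2 hT.le⟩)
  refine ⟨fun x => v₀ + ∫ s in (0 : ℝ)..x, g s, fun s => ?_, ?_⟩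
  · rw [toDom_add, hv₀, ← hg.2 ⟨0, left_mem_Icc.2 hT.le⟩ s]
  · rw [projIcc_of_mem hT.le hrI]
    have := hr1 (by rwa [uIcc_of_le hT.le]) 0 (by simp)
    exact (this.const_add v₀).hasDerivWithinAt

theorem IsWeakDeriv.congr {γ : Curve Λ T} {g g' : ℝ → Euc d}
    (hg : IsWeakDeriv γ g) (h : g =ᵐ[volume.restrict (Ioc 0 T)] g') : IsWeakDeriv γ g' := by
  refine ⟨(memLp_congr_ae h).1 hg.1, fun s t => ?_⟩
  rw [hg.2 s t, intervalIntegral.integral_congr_ae]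
  filter_upwards [(ae_restrict_iff' measurableSet_Ioc).1 h] with r hr hr'
  refine hr (Ioc_subset_Ioc ?_ ?_ hr')
  · exact le_min s.2.1 t.2.1
  · exact max_le s.2.2 t.2.2

theorem IsH1.isWeakDeriv (h : IsSeparated Λ ρ) (hT : 0 < T) {γ : Curve Λ T} (hγ : IsH1 γ) :
    IsWeakDeriv γ (velocity' ρ hT.le γ) := by
  obtain ⟨g, hg⟩ := isH1_iff.1 hγ
  exact hg.congr (hg.ae_eq h hT).symm

theorem IsWeakDeriv.sub {γ ω : Curve Λ T} {f g : ℝ → Euc d} (hf : IsWeakDeriv γ f)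
    (hg : IsWeakDeriv ω g) : IsWeakDeriv (γ - ω) (f - g) := by
  refine ⟨hf.1.sub hg.1, fun s t => ?_⟩
  have h1 := intervalIntegrable_of_memLp_two hf.1 s.2 t.2
  have h2 := intervalIntegrable_of_memLp_two hg.1 s.2 t.2
  simp only [Pi.sub_apply, ContinuousMap.sub_apply]
  rw [intervalIntegral.integral_sub h1 h2, toDom_sub, hf.2 s t, hg.2 s t]
  abel

theorem isWeakDeriv_const (x : Dom Λ) : IsWeakDeriv (ContinuousMap.const (Icc (0 : ℝ) T) x) 0 :=
  ⟨MemLp.zero, fun s t => by simp⟩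

theorem IsWeakDeriv.add_toDom {γ : Curve Λ T} {f g φ : ℝ → Euc d} (hf : IsWeakDeriv γ f)
    (hg : MemLp g 2 (volume.restrict (Ioc 0 T))) (hφ : Continuous φ)
    (h : ∀ s t : Icc (0 : ℝ) T, φ t = φ s + ∫ r in (s : ℝ)..t, g r) :
    IsWeakDeriv (γ + ⟨fun t => toDom Λ (φ t), continuous_toDom.comp (hφ.comp continuous_subtype_val)⟩)
      (f + g) := by
  refine ⟨hf.1.add hg, fun s t => ?_⟩
  have h1 := intervalIntegrable_of_memLp_two hf.1 s.2 t.2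
  have h2 := intervalIntegrable_of_memLp_two hg s.2 t.2
  simp only [Pi.add_apply, ContinuousMap.add_apply, ContinuousMap.coe_mk]
  rw [intervalIntegral.integral_add h1 h2, toDom_add, hf.2 s t, h s t, toDom_add]
  abel

theorem IsWeakDeriv.isH1 {γ : Curve Λ T} {f : ℝ → Euc d} (hf : IsWeakDeriv γ f) : IsH1 γ :=
  isH1_iff.2 ⟨f, hf⟩

theorem IsWeakDeriv.kinetic_eq (h : IsSeparated Λ ρ) (hT : 0 < T) {γ : Curve Λ T} {f : ℝ → Euc d}
    (hf : IsWeakDeriv γ f) : kinetic γ = 2⁻¹ * ∫⁻ r in Ioc 0 T, ‖f r‖ₑ ^ 2 := by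
  rw [kinetic, if_pos hf.isH1, lintegral_timeMeasure hT.le]
  congr 1
  refine lintegral_congr_ae ?_
  filter_upwards [hf.ae_eq h hT, h.ae_velocity'_eq hT γ] with r h1 h2
  rw [h2, h1]

theorem IsWeakDeriv.lintegral_lt_top {γ : Curve Λ T} {f : ℝ → Euc d} (hf : IsWeakDeriv γ f) :
    ∫⁻ r in Ioc 0 T, ‖f r‖ₑ ^ 2 < ⊤ := by
  have := hf.1.eLpNorm_lt_top
  rw [eLpNorm_lt_top_iff_lintegral_rpow_enorm_lt_top two_ne_zero ENNReal.ofNat_ne_top] at this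
  simpa using this

theorem isH1_of_kinetic_ne_top {γ : Curve Λ T} (hγ : kinetic γ ≠ ⊤) : IsH1 γ := by
  by_contra h
  exact hγ (by rw [kinetic, if_neg h])

theorem IsWeakDeriv.interaction_eq (h : IsSeparated Λ ρ) (hT : 0 < T) (η : Dom Λ → ℝ)
    {γ ω : Curve Λ T} {f g : ℝ → Euc d} (hf : IsWeakDeriv γ f) (hg : IsWeakDeriv ω g) :
    interaction η γ ω = 2⁻¹ * ∫⁻ r in Ioc 0 T, ‖f r - g r‖ₑ ^ 2 *
      ENNReal.ofReal (η (γ (projIcc 0 T hT.le r) - ω (projIcc 0 T hT.le r))) := by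
  have hs := hf.sub hg
  rw [interaction, if_pos hs.isH1, lintegral_timeMeasure hT.le]
  congr 1
  refine lintegral_congr_ae ?_
  filter_upwards [hs.ae_eq h hT, h.ae_velocity'_eq hT (γ - ω)] with r h1 h2
  rw [h2, h1, Pi.sub_apply]

/-- The energy bound on the displacement of a curve, in the form used against linear costs. -/
theorem IsWeakDeriv.norm_sub_le {γ : Curve Λ T} {f : ℝ → Euc d}
    (hf : IsWeakDeriv γ f) (s t : Icc (0 : ℝ) T) :
    ‖γ t - γ s‖ ≤ ∫ r in Ioc 0 T, ‖f r‖ := by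
  rw [hf.2 s t, add_sub_cancel_left]
  refine (norm_toDom_le _).trans (intervalIntegral.norm_integral_le_integral_norm_uIoc.trans ?_)
  refine setIntegral_mono_set (hf.1.integrable one_le_two).norm (ae_of_all _ fun _ => norm_nonneg _) ?_
  exact (Ioc_subset_Ioc (le_min s.2.1 t.2.1) (max_le s.2.2 t.2.2)).eventuallyLE

end SobolevCurves

/-! ### From the gradient bound to exponential growth of the kernel. -/

section LogLipschitz

/-- A Lipschitz function on the line with `g' ≤ c g` almost everywhere grows at most
exponentially. -/
theorem LipschitzWith.le_exp_mul_of_ae_deriv_le {g : ℝ → ℝ} {K : ℝ≥0} (hg : LipschitzWith K g)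
    {c : ℝ} (h : ∀ᵐ t, DifferentiableAt ℝ g t → deriv g t ≤ c * g t) :
    g 1 ≤ Real.exp c * g 0 := by
  have h1 : AbsolutelyContinuousOnInterval g 0 1 :=
    (hg.lipschitzOnWith (s := uIcc 0 1)).absolutelyContinuousOnInterval
  let e : ℝ → ℝ := fun t => Real.exp (-c * t)
  have hd : ∀ t, HasDerivAt e (-c * e t) t := fun t => by
    have := ((hasDerivAt_id t).const_mul (-c)).exp
    simpa [e, mul_comm] using this
  have h2 : AbsolutelyContinuousOnInterval e 0 1 := by
    have hs : ContDiff ℝ 1 e := by fun_prop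
    obtain ⟨L, hL⟩ := hs.contDiffOn.exists_lipschitzOnWith one_ne_zero
      (convex_uIcc (0 : ℝ) 1) isCompact_uIcc
    exact hL.absolutelyContinuousOnInterval
  have h3 := h2.integral_deriv_mul_eq_sub h1
  -- The integrand is `(e g)' = e (g' - c g)`, which is nonpositive almost everywhere.
  have h4 : ∫ x in (0 : ℝ)..1, (deriv e x * g x + e x * deriv g x) ≤ 0 := by
    rw [intervalIntegral.integral_of_le zero_le_one]
    refine setIntegral_nonpos_ae measurableSet_Ioc ?_
    filter_upwards [h, hg.ae_differentiableAt_real] with t ht hdt _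
    rw [(hd t).deriv]
    have := mul_nonneg (Real.exp_pos (-c * t)).le (sub_nonneg.2 (ht hdt))
    simp only [e]
    linarith
  rw [h3] at h4
  have h5 : Real.exp c * e 1 = 1 := by simp [e, ← Real.exp_add]
  have h6 := mul_le_mul_of_nonneg_left h4 (Real.exp_pos c).le
  have h7 : e 0 = 1 := by simp [e]
  rw [mul_sub, ← mul_assoc, h5, h7] at h6
  linarith

variable {E : Type*} [NormedAddCommGroup E] [InnerProductSpace ℝ E] [FiniteDimensional ℝ E]
  [MeasurableSpace E] [BorelSpace E]

/-- A Lipschitz function with `|∇f| ≤ C f` grows at most exponentially. -/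
theorem LipschitzWith.le_exp_mul_of_fderiv_le {f : E → ℝ} {K : ℝ≥0} (hf : LipschitzWith K f)
    {C : ℝ} (h : ∀ x, DifferentiableAt ℝ f x → ‖fderiv ℝ f x‖ ≤ C * f x) (x v : E) :
    f (x + v) ≤ Real.exp (C * ‖v‖) * f x := by
  set μ : Measure E := volume
  have hN : ∀ᵐ x ∂μ, DifferentiableAt ℝ f x := hf.ae_differentiableAt
  set N := toMeasurable μ {x | ¬ DifferentiableAt ℝ f x}
  have hN0 : μ N = 0 := by rw [measure_toMeasurable]; exact hN
  have hNd : ∀ x, x ∉ N → DifferentiableAt ℝ f x := fun x hx => by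
    by_contra h
    exact hx (subset_toMeasurable _ _ h)
  -- By Fubini, almost every line in the direction `v` meets the Rademacher null set in a null set
  -- of times. Passing to a measurable hull `N` makes Fubini applicable; continuity later removes
  -- the exceptional base points.
  have h1 : ∀ᵐ x ∂μ, ∀ᵐ t : ℝ, x + t • v ∉ N := by
    have hm : MeasurableSet {p : E × ℝ | p.1 + p.2 • v ∉ N} := by
      have : Measurable fun p : E × ℝ => p.1 + p.2 • v := by fun_prop
      exact this (measurableSet_toMeasurable _ _).compl
    rw [Measure.ae_ae_comm hm]
    refine ae_of_all _ fun t => ?_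
    have : μ ((fun x => x + t • v) ⁻¹' N) = 0 := by rw [measure_preimage_add_right, hN0]
    exact measure_eq_zero_iff_ae_notMem.1 this
  have h2 : ∀ᵐ x ∂μ, f (x + v) ≤ Real.exp (C * ‖v‖) * f x := by
    filter_upwards [h1] with y hy
    have hl : LipschitzWith (K * ‖v‖₊) fun t : ℝ => f (y + t • v) := by
      refine hf.comp (LipschitzWith.of_dist_le_mul fun s t => ?_)
      rw [dist_add_left, dist_eq_norm, ← sub_smul, norm_smul, mul_comm, dist_eq_norm]
      rfl
    have := hl.le_exp_mul_of_ae_deriv_le (c := C * ‖v‖) ?_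
    · simpa using this
    · filter_upwards [hy] with t ht _
      have hd := hNd _ ht
      have h3 : HasDerivAt (fun t : ℝ => f (y + t • v)) (fderiv ℝ f (y + t • v) v) t := by
        have h4 : HasDerivAt (fun t : ℝ => y + t • v) v t := by
          simpa using ((hasDerivAt_id t).smul_const v).const_add y
        exact hd.hasFDerivAt.comp_hasDerivAt t h4
      rw [h3.deriv]
      calc fderiv ℝ f (y + t • v) v ≤ ‖fderiv ℝ f (y + t • v)‖ * ‖v‖ :=
            (le_abs_self _).trans ((fderiv ℝ f (y + t • v)).le_opNorm v)
        _ ≤ C * f (y + t • v) * ‖v‖ := by gcongr; exact h _ hd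
        _ = _ := by ring
  have hc : Continuous fun x => Real.exp (C * ‖v‖) * f x - f (x + v) := by
    have := hf.continuous
    fun_prop
  have h3 : IsClosed {x | 0 ≤ Real.exp (C * ‖v‖) * f x - f (x + v)} :=
    isClosed_le continuous_const hc
  have h4 : Dense {x | 0 ≤ Real.exp (C * ‖v‖) * f x - f (x + v)} :=
    Measure.dense_of_ae (μ := μ) (by filter_upwards [h2] with x hx using sub_nonneg.2 hx)
  have h5 : x ∈ {x | 0 ≤ Real.exp (C * ‖v‖) * f x - f (x + v)} :=
    h3.closure_subset (h4 x)
  exact sub_nonneg.1 h5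

/-- The kernel grows at most exponentially. -/
theorem Game.exists_le_exp_mul {d : ℕ} {Λ : AddSubgroup (Euc d)} (G : Game Λ)
    (hη_pos : ∀ x, 0 < G.η x) (hη_lip : ∃ C : ℝ≥0, LipschitzWith C G.η)
    (hη_grad : ∃ C : ℝ, ∀ x, DiffAt G.η x → ‖grad G.η x‖ ≤ C * G.η x) :
    ∃ C : ℝ, 0 ≤ C ∧ ∀ x v, G.η (x + toDom Λ v) ≤ Real.exp (C * ‖v‖) * G.η x := by
  obtain ⟨K, hK⟩ := hη_lip
  obtain ⟨C, hC⟩ := hη_grad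
  refine ⟨max C 0, le_max_right _ _, fun x v => ?_⟩
  have hl : LipschitzWith K fun y => G.η (toDom Λ y) := by
    have : LipschitzWith 1 (toDom Λ) := LipschitzWith.of_dist_le_mul fun y z => by
      rw [dist_eq_norm, dist_eq_norm, ← toDom_sub, NNReal.coe_one, one_mul]
      exact norm_toDom_le _
    have h1 := hK.comp this
    rw [mul_one] at h1
    exact h1
  obtain ⟨y, rfl⟩ := exists_toDom_eq x
  rw [← toDom_add]
  refine hl.le_exp_mul_of_fderiv_le (fun z hz => ?_) y v
  let F : Euc d → ℝ := fun y => G.η (toDom Λ y)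
  have h1 : inChart G.η (toDom Λ z) = fun h => F (z + h) := rfl
  have h2 : fderiv ℝ (fun h => F (z + h)) 0 = fderiv ℝ F z := by
    rw [fderiv_comp_add_left, add_zero]
  have h3 : DiffAt G.η (toDom Λ z) := by
    rw [DiffAt, h1, differentiableAt_comp_add_left, add_zero]
    exact hz
  have h4 := hC _ h3
  rw [grad, gradient, LinearIsometryEquiv.norm_map, h1, h2] at h4
  exact h4.trans (mul_le_mul_of_nonneg_right (le_max_left _ _) (hη_pos _).le)

end LogLipschitz

/-! ### Piecewise linear test functions. -/

section Ramp

/-- The density of the uniform distribution on `(a,b]`. -/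
noncomputable def rampDeriv (a b : ℝ) : ℝ → ℝ := (Ioc a b).indicator fun _ => (b - a)⁻¹

/-- The ramp which rises linearly from `0` to `1` on `[a,b]`. -/
noncomputable def ramp (a b x : ℝ) : ℝ := ∫ r in (0 : ℝ)..x, rampDeriv a b r

theorem measurable_rampDeriv (a b : ℝ) : Measurable (rampDeriv a b) :=
  measurable_const.indicator measurableSet_Ioc

theorem abs_rampDeriv_le {a b : ℝ} (hab : a < b) (r : ℝ) : |rampDeriv a b r| ≤ (b - a)⁻¹ := by
  have : 0 ≤ (b - a)⁻¹ := inv_nonneg.2 (sub_nonneg.2 hab.le)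
  rw [rampDeriv, indicator_apply]
  split_ifs
  · rw [abs_of_nonneg this]
  · simpa using this

theorem intervalIntegrable_rampDeriv {a b : ℝ} (hab : a < b) (x y : ℝ) :
    IntervalIntegrable (rampDeriv a b) volume x y := by
  refine (intervalIntegrable_const (c := (b - a)⁻¹)).mono_fun
    (measurable_rampDeriv a b).aestronglyMeasurable (ae_of_all _ fun r => ?_)
  simp only [Real.norm_eq_abs]
  exact (abs_rampDeriv_le hab r).trans (le_abs_self _)

theorem ramp_eq {a b x : ℝ} (ha : 0 ≤ a) (hx : 0 ≤ x) :
    ramp a b x = max (min x b - a) 0 * (b - a)⁻¹ := by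
  rw [ramp, intervalIntegral.integral_of_le hx, rampDeriv, setIntegral_indicator measurableSet_Ioc,
    Ioc_inter_Ioc, setIntegral_const, max_eq_right ha, smul_eq_mul, Real.volume_real_Ioc]

theorem ramp_nonneg {a b x : ℝ} (ha : 0 ≤ a) (hab : a < b) (hx : 0 ≤ x) : 0 ≤ ramp a b x := by
  rw [ramp_eq ha hx]
  exact mul_nonneg (le_max_right _ _) (inv_nonneg.2 (sub_nonneg.2 hab.le))

theorem ramp_le_one {a b x : ℝ} (ha : 0 ≤ a) (hab : a < b) (hx : 0 ≤ x) : ramp a b x ≤ 1 := by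
  rw [ramp_eq ha hx, ← div_eq_mul_inv, div_le_one (sub_pos.2 hab)]
  exact max_le (sub_le_sub_right (min_le_right _ _) _) (sub_pos.2 hab).le

theorem ramp_eq_zero {a b x : ℝ} (ha : 0 ≤ a) (hx : 0 ≤ x) (hxa : x ≤ a) : ramp a b x = 0 := by
  rw [ramp_eq ha hx, max_eq_right (sub_nonpos.2 ((min_le_left _ _).trans hxa)), zero_mul]

theorem ramp_eq_one {a b x : ℝ} (ha : 0 ≤ a) (hab : a < b) (hxb : b ≤ x) : ramp a b x = 1 := by
  rw [ramp_eq ha ((ha.trans hab.le).trans hxb), min_eq_right hxb,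
    max_eq_left (sub_pos.2 hab).le, mul_inv_cancel₀ (sub_pos.2 hab).ne']

theorem continuous_ramp {a b : ℝ} (hab : a < b) : Continuous (ramp a b) :=
  intervalIntegral.continuous_primitive (intervalIntegrable_rampDeriv hab) 0

variable {E : Type*} [NormedAddCommGroup E] [InnerProductSpace ℝ E] [CompleteSpace E]

/-- The mean of `p` over `[a,b]`. -/
noncomputable def meanOn (p : ℝ → E) (a b : ℝ) : E := (b - a)⁻¹ • ∫ r in a..b, p r

/-- Testing `p` with the slope of a ramp returns the mean of `p` over the ramp; shrinking the ramp
then recovers pointwise values of `p`. -/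
theorem integral_inner_rampDeriv_smul {T a b : ℝ} {p : ℝ → E} (hp : IntervalIntegrable p volume 0 T)
    (ha : 0 ≤ a) (hab : a < b) (hb : b ≤ T) (e : E) :
    IntervalIntegrable (fun r => inner ℝ (p r) (rampDeriv a b r • e)) volume 0 T ∧
    ∫ r in (0 : ℝ)..T, inner ℝ (p r) (rampDeriv a b r • e) = inner ℝ (meanOn p a b) e := by
  have hT : 0 ≤ T := by linarith
  have h1 : (fun r => inner ℝ (p r) (rampDeriv a b r • e)) =
      (Ioc a b).indicator fun r => (b - a)⁻¹ * inner ℝ (p r) e := by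
    ext r
    by_cases hr : r ∈ Ioc a b <;> simp [rampDeriv, hr, inner_smul_right]
  have hp' : IntegrableOn p (Ioc 0 T) := (intervalIntegrable_iff_integrableOn_Ioc_of_le hT).1 hp
  have hab' : Ioc a b ⊆ Ioc 0 T := Ioc_subset_Ioc ha hb
  have h2 : IntegrableOn (fun r => (b - a)⁻¹ * inner ℝ (p r) e) (Ioc 0 T) :=
    (hp'.inner_const e).const_mul _
  rw [h1]
  refine ⟨(intervalIntegrable_iff_integrableOn_Ioc_of_le hT).2
    (h2.indicator measurableSet_Ioc), ?_⟩
  rw [intervalIntegral.integral_of_le hT, setIntegral_indicator measurableSet_Ioc,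
    inter_eq_self_of_subset_right hab', meanOn, inner_smul_left, integral_const_mul,
    intervalIntegral.integral_of_le hab.le]
  simp only [real_inner_comm e, RCLike.conj_to_real]
  rw [integral_inner (hp'.mono_set hab')]

end Ramp

/-! ### The first variation inequality tested on trapezoids and ramps. -/

section Momentum

variable {E : Type*} [NormedAddCommGroup E] [InnerProductSpace ℝ E]

/-- The first variation inequality of a minimization problem on `[0,T]` with free end point, in
terms of the velocity part `p` of the variation, the difference quotients `Θ n` of the position
part, and the difference quotients `ψ n` of the final cost. -/
structure FirstVariation (T : ℝ) (p : ℝ → E) (k : ℝ → ℝ) (Θ : ℕ → ℝ → E → ℝ) (ψ : ℕ → E → ℝ)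
    (L : ℝ) : Prop where
  pos : 0 < T
  int_p : Integrable p
  int_k : Integrable k
  k_nonneg : ∀ r, 0 ≤ k r
  meas : ∀ n (φ : ℝ → E), Continuous φ →
    AEStronglyMeasurable (fun r => Θ n r (φ r)) (volume.restrict (Ioc 0 T))
  bound : ∀ᵐ r ∂volume.restrict (Ioc 0 T), ∀ n h, ‖h‖ ≤ 1 → |Θ n r h| ≤ k r * ‖h‖
  bound_final : ∀ n h, |ψ n h| ≤ L * ‖h‖
  variation : ∀ g : ℝ → E, StronglyMeasurable g → (∃ C, ∀ r, ‖g r‖ ≤ C) →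
    (∀ x ∈ Icc 0 T, ‖∫ r in (0 : ℝ)..x, g r‖ ≤ 1) → ∀ ε > 0, ∀ᶠ n in atTop,
      0 ≤ (∫ r in (0 : ℝ)..T, inner ℝ (p r) (g r)) +
        (∫ r in (0 : ℝ)..T, Θ n r (∫ s in (0 : ℝ)..r, g s)) +
        ψ n (∫ s in (0 : ℝ)..T, g s) + ε

namespace FirstVariation

variable {T : ℝ} {p : ℝ → E} {k : ℝ → ℝ} {Θ : ℕ → ℝ → E → ℝ} {ψ : ℕ → E → ℝ} {L : ℝ}

theorem integrable_Θ (H : FirstVariation T p k Θ ψ L) (n : ℕ) {φ : ℝ → E} (hφ : Continuous φ)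
    (h1 : ∀ x ∈ Icc 0 T, ‖φ x‖ ≤ 1) : IntegrableOn (fun r => Θ n r (φ r)) (Ioc 0 T) := by
  refine H.int_k.integrableOn.mono' (H.meas n φ hφ) ?_
  filter_upwards [H.bound, ae_restrict_mem measurableSet_Ioc] with r hr hrT
  have h2 := h1 r (Ioc_subset_Icc_self hrT)
  rw [Real.norm_eq_abs]
  exact (hr n _ h2).trans (mul_le_of_le_one_right (H.k_nonneg r) h2)

variable [CompleteSpace E]

/-- The variation along a trapezoid. -/
theorem inner_meanOn_sub_le (H : FirstVariation T p k Θ ψ L) {a b a' b' : ℝ} (ha : 0 ≤ a)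
    (hab : a < b) (hba : b ≤ a') (hab' : a' < b') (hb : b' ≤ T) {e : E} (he : ‖e‖ ≤ 1)
    {D : ℝ → ℝ} (hD : IntegrableOn D (Ioc 0 T)) {N : ℕ}
    (hΘ : ∀ᵐ r ∂volume.restrict (Ioc 0 T), ∀ n ≥ N, Θ n r e ≤ D r) :
    inner ℝ (meanOn p a' b' - meanOn p a b) e ≤
      (∫ r in a..b, k r) + (∫ r in b..a', D r) + ∫ r in a'..b', k r := by
  have hT := H.pos.le
  have ha' : 0 ≤ a' := by linarith
  -- The primitive `φ` of `g` rises to `e` on `[a,b]`, stays there until `a'` and returns to zero on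
  -- `[a',b']`; as `φ T = 0`, the final cost does not enter.
  set g : ℝ → E := fun r => rampDeriv a b r • e - rampDeriv a' b' r • e with hg
  set φ : ℝ → E := fun x => (ramp a b x - ramp a' b' x) • e with hφ
  have hgφ : ∀ x, ∫ r in (0 : ℝ)..x, g r = φ x := fun x => by
    simp only [hg, ← sub_smul]
    rw [intervalIntegral.integral_smul_const, intervalIntegral.integral_sub
      (intervalIntegrable_rampDeriv hab _ _) (intervalIntegrable_rampDeriv hab' _ _)]
    rfl
  have hcoef : ∀ x, 0 ≤ x → 0 ≤ ramp a b x - ramp a' b' x ∧ ramp a b x - ramp a' b' x ≤ 1 := by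
    intro x hx
    refine ⟨?_, by linarith [ramp_le_one ha hab hx, ramp_nonneg ha' hab' hx]⟩
    rcases le_total x a' with h | h
    · rw [ramp_eq_zero ha' hx h, sub_zero]
      exact ramp_nonneg ha hab hx
    · rw [ramp_eq_one ha hab (hba.trans h)]
      linarith [ramp_le_one ha' hab' hx]
  have hφ1 : ∀ x ∈ Icc 0 T, ‖φ x‖ ≤ 1 := fun x hx => by
    rw [hφ, norm_smul, Real.norm_eq_abs, abs_of_nonneg (hcoef x hx.1).1]
    exact mul_le_one₀ (hcoef x hx.1).2 (norm_nonneg _) he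
  have hφc : Continuous φ := ((continuous_ramp hab).sub (continuous_ramp hab')).smul continuous_const
  have hgm : StronglyMeasurable g :=
    ((measurable_rampDeriv a b).stronglyMeasurable.smul_const e).sub
      ((measurable_rampDeriv a' b').stronglyMeasurable.smul_const e)
  have hgb : ∃ C, ∀ r, ‖g r‖ ≤ C := by
    refine ⟨(b - a)⁻¹ * ‖e‖ + (b' - a')⁻¹ * ‖e‖, fun r => (norm_sub_le _ _).trans ?_⟩
    rw [norm_smul, norm_smul]
    gcongr
    · exact abs_rampDeriv_le hab r
    · exact abs_rampDeriv_le hab' r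
  have hφT : φ T = 0 := by
    simp only [hφ]
    rw [ramp_eq_one ha hab (by linarith), ramp_eq_one ha' hab' hb, sub_self, zero_smul]
  have hψ : ∀ n, ψ n (φ T) = 0 := fun n => by
    have := H.bound_final n (φ T)
    rw [hφT, norm_zero, mul_zero] at this
    rw [hφT]
    exact abs_nonpos_iff.1 this
  obtain ⟨hi1, he1⟩ := integral_inner_rampDeriv_smul (T := T) H.int_p.intervalIntegrable ha hab (by linarith) e
  obtain ⟨hi2, he2⟩ := integral_inner_rampDeriv_smul (T := T) H.int_p.intervalIntegrable ha' hab' hb e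
  have hinner : ∫ r in (0 : ℝ)..T, inner ℝ (p r) (g r) =
      inner ℝ (meanOn p a b) e - inner ℝ (meanOn p a' b') e := by
    simp only [hg, inner_sub_right]
    rw [intervalIntegral.integral_sub hi1 hi2, he1, he2]
  -- Majorant of the position term: `D` on the plateau, where the argument is exactly `e`; `k` on
  -- the two flanks; zero where `φ = 0`, since `bound` forces the quotients to vanish there.
  set F : ℝ → ℝ := (Ioc a b).indicator k + (Ioc b a').indicator D +
    (Ioc a' b').indicator k with hF
  have s1 : Ioc a b ⊆ Ioc 0 T := Ioc_subset_Ioc ha (by linarith)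
  have s2 : Ioc b a' ⊆ Ioc 0 T := Ioc_subset_Ioc (by linarith) (by linarith)
  have s3 : Ioc a' b' ⊆ Ioc 0 T := Ioc_subset_Ioc ha' hb
  have i1 : IntegrableOn ((Ioc a b).indicator k) (Ioc 0 T) := H.int_k.integrableOn.indicator measurableSet_Ioc
  have i2 : IntegrableOn ((Ioc b a').indicator D) (Ioc 0 T) := hD.indicator measurableSet_Ioc
  have i3 : IntegrableOn ((Ioc a' b').indicator k) (Ioc 0 T) := H.int_k.integrableOn.indicator measurableSet_Ioc
  have hFi : ∫ r in Ioc 0 T, F r =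
      (∫ r in a..b, k r) + (∫ r in b..a', D r) + ∫ r in a'..b', k r := by
    rw [hF, integral_add' (i1.add i2) i3, integral_add' i1 i2,
      setIntegral_indicator measurableSet_Ioc, setIntegral_indicator measurableSet_Ioc,
      setIntegral_indicator measurableSet_Ioc, inter_eq_self_of_subset_right s1,
      inter_eq_self_of_subset_right s2, inter_eq_self_of_subset_right s3,
      intervalIntegral.integral_of_le hab.le, intervalIntegral.integral_of_le hba,
      intervalIntegral.integral_of_le hab'.le]
  have hle : ∀ n ≥ N, ∫ r in Ioc 0 T, Θ n r (φ r) ≤ ∫ r in Ioc 0 T, F r := fun n hn => by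
    refine integral_mono_ae (H.integrable_Θ n hφc hφ1) ((i1.add i2).add i3) ?_
    filter_upwards [H.bound, hΘ, ae_restrict_mem measurableSet_Ioc] with r hr hr2 hrT
    have hn1 := hφ1 r (Ioc_subset_Icc_self hrT)
    have hk : Θ n r (φ r) ≤ k r :=
      (le_abs_self _).trans ((hr n _ hn1).trans (mul_le_of_le_one_right (H.k_nonneg r) hn1))
    have hz : φ r = 0 → Θ n r (φ r) ≤ 0 := fun h0 => by
      have := hr n _ hn1
      rw [h0, norm_zero, mul_zero] at this
      rw [h0]
      exact (abs_nonpos_iff.1 this).le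
    simp only [hF, Pi.add_apply]
    rcases le_or_gt r a with h1 | h1
    · have : φ r = 0 := by
        simp only [hφ]
        rw [ramp_eq_zero ha hrT.1.le h1, ramp_eq_zero ha' hrT.1.le (by linarith), sub_self,
          zero_smul]
      simpa [h1.not_gt, (show ¬ b < r by linarith), (show ¬ a' < r by linarith)] using hz this
    rcases le_or_gt r b with h2 | h2
    · simpa [h1, h2, (show ¬ b < r by linarith), (show ¬ a' < r by linarith)] using hk
    rcases le_or_gt r a' with h3 | h3
    · have : φ r = e := by
        simp only [hφ]
        rw [ramp_eq_one ha hab h2.le, ramp_eq_zero ha' hrT.1.le h3, sub_zero, one_smul]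
      rw [this]
      simpa [h2, h3, (show ¬ r ≤ b by linarith), (show ¬ a' < r by linarith)] using hr2 n hn
    rcases le_or_gt r b' with h4 | h4
    · simpa [h3, h4, (show ¬ r ≤ b by linarith), (show ¬ r ≤ a' by linarith)] using hk
    · have : φ r = 0 := by
        simp only [hφ]
        rw [ramp_eq_one ha hab h2.le, ramp_eq_one ha' hab' h4.le, sub_self, zero_smul]
      simpa [(show ¬ r ≤ b by linarith), (show ¬ r ≤ a' by linarith),
        (show ¬ r ≤ b' by linarith)] using hz this
  rw [← hFi, inner_sub_left]
  refine le_of_forall_pos_le_add fun ε hε => ?_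
  obtain ⟨n, hn, hnN⟩ := ((H.variation g hgm hgb (by simpa only [hgφ] using hφ1) ε hε).and
    (eventually_ge_atTop N)).exists
  simp only [hgφ] at hn
  rw [hψ, hinner, intervalIntegral.integral_of_le hT] at hn
  linarith [hle n hnN]

/-- The variation along a ramp. -/
theorem inner_meanOn_nonneg (H : FirstVariation T p k Θ ψ L) {a b : ℝ} (ha : 0 ≤ a)
    (hab : a < b) (hb : b ≤ T) {e : E} (he : ‖e‖ ≤ 1) {c : ℝ} (hc : ∀ᶠ n in atTop, ψ n e ≤ c) :
    0 ≤ inner ℝ (meanOn p a b) e + (∫ r in a..T, k r) + c := by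
  have hT := H.pos.le
  have haT : a ≤ T := hab.le.trans hb
  set g : ℝ → E := fun r => rampDeriv a b r • e with hg
  set φ : ℝ → E := fun x => ramp a b x • e with hφ
  have hgφ : ∀ x, ∫ r in (0 : ℝ)..x, g r = φ x := fun x => by
    simp only [hg]
    rw [intervalIntegral.integral_smul_const]
    rfl
  have hφ1 : ∀ x ∈ Icc 0 T, ‖φ x‖ ≤ 1 := fun x hx => by
    rw [hφ, norm_smul, Real.norm_eq_abs, abs_of_nonneg (ramp_nonneg ha hab hx.1)]
    exact mul_le_one₀ (ramp_le_one ha hab hx.1) (norm_nonneg _) he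
  have hφc : Continuous φ := (continuous_ramp hab).smul continuous_const
  have hgm : StronglyMeasurable g := (measurable_rampDeriv a b).stronglyMeasurable.smul_const e
  have hgb : ∃ C, ∀ r, ‖g r‖ ≤ C := by
    refine ⟨(b - a)⁻¹ * ‖e‖, fun r => ?_⟩
    rw [hg, norm_smul]
    gcongr
    exact abs_rampDeriv_le hab r
  have hφT : φ T = e := by
    simp only [hφ]
    rw [ramp_eq_one ha hab hb, one_smul]
  obtain ⟨hi1, he1⟩ := integral_inner_rampDeriv_smul (T := T) H.int_p.intervalIntegrable ha hab hb e
  have i1 : IntegrableOn ((Ioc a T).indicator k) (Ioc 0 T) := H.int_k.integrableOn.indicator measurableSet_Ioc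
  have hFi : ∫ r in Ioc 0 T, (Ioc a T).indicator k r = ∫ r in a..T, k r := by
    rw [setIntegral_indicator measurableSet_Ioc,
      inter_eq_self_of_subset_right (Ioc_subset_Ioc_left ha), intervalIntegral.integral_of_le haT]
  have hle : ∀ n, ∫ r in Ioc 0 T, Θ n r (φ r) ≤ ∫ r in a..T, k r := fun n => by
    rw [← hFi]
    refine integral_mono_ae (H.integrable_Θ n hφc hφ1) i1 ?_
    filter_upwards [H.bound, ae_restrict_mem measurableSet_Ioc] with r hr hrT
    have hn1 := hφ1 r (Ioc_subset_Icc_self hrT)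
    have hk := (le_abs_self _).trans (hr n _ hn1)
    rcases le_or_gt r a with h1 | h1
    · have : φ r = 0 := by
        simp only [hφ]
        rw [ramp_eq_zero ha hrT.1.le h1, zero_smul]
      rw [this, norm_zero, mul_zero] at hk
      simpa [this, h1.not_gt] using hk
    · rw [indicator_of_mem (show r ∈ Ioc a T from ⟨h1, hrT.2⟩)]
      exact hk.trans (mul_le_of_le_one_right (H.k_nonneg r) hn1)
  refine le_of_forall_pos_le_add fun ε hε => ?_
  obtain ⟨n, hn, hnN⟩ := ((H.variation g hgm hgb (by simpa only [hgφ] using hφ1) ε hε).and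
    hc).exists
  simp only [hgφ] at hn
  rw [hφT, he1, intervalIntegral.integral_of_le hT] at hn
  linarith [hle n]

end FirstVariation

end Momentum

/-! ### The absolutely continuous momentum, its derivative and its final value. -/

section Momentum

variable {E : Type*} [NormedAddCommGroup E] [InnerProductSpace ℝ E]

theorem norm_le_of_forall_inner_le {x : E} {c : ℝ} (h : ∀ e : E, ‖e‖ ≤ 1 → inner ℝ x e ≤ c) :
    ‖x‖ ≤ c := by
  rcases eq_or_ne x 0 with rfl | hx
  · simpa using h 0 (by simp)
  · have h1 : ‖(‖x‖⁻¹ • x : E)‖ ≤ 1 := by simp [norm_smul, hx]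
    have h2 := h _ h1
    rw [inner_smul_right, real_inner_self_eq_norm_sq, pow_two, inv_mul_cancel_left₀
      (norm_ne_zero_iff.2 hx)] at h2
    exact h2

theorem tendsto_meanOn_right {p : ℝ → E} (hp : ∀ a b, IntervalIntegrable p volume a b) {t : ℝ}
    {v : E} (h : HasDerivAt (fun x => ∫ r in (0 : ℝ)..x, p r) v t) :
    Tendsto (fun h => meanOn p t (t + h)) (𝓝[>] 0) (𝓝 v) := by
  refine h.tendsto_slope_zero_right.congr fun h => ?_
  rw [meanOn, intervalIntegral.integral_interval_sub_left (hp _ _) (hp _ _), add_sub_cancel_left]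

theorem tendsto_meanOn_left {p : ℝ → E} (hp : ∀ a b, IntervalIntegrable p volume a b) {t : ℝ}
    {v : E} (h : HasDerivAt (fun x => ∫ r in (0 : ℝ)..x, p r) v t) :
    Tendsto (fun h => meanOn p (t - h) t) (𝓝[>] 0) (𝓝 v) := by
  have h1 : Tendsto (fun x : ℝ => -x) (𝓝[>] 0) (𝓝[<] 0) := by
    simpa using tendsto_neg_nhdsGT (a := (0 : ℝ))
  refine (h.tendsto_slope_zero_left.comp h1).congr fun h => ?_
  simp only [Function.comp]
  rw [meanOn, intervalIntegral.integral_interval_sub_left (hp _ _) (hp _ _),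
    intervalIntegral.integral_symm, ← sub_eq_add_neg, sub_sub_cancel, inv_neg, neg_smul, smul_neg,
    neg_neg]

theorem meanOn_congr {p z : ℝ → E} {T : ℝ} (h : z =ᵐ[volume.restrict (Ioc 0 T)] p) {a b : ℝ}
    (ha : 0 ≤ a) (hab : a ≤ b) (hb : b ≤ T) : meanOn p a b = meanOn z a b := by
  rw [meanOn, meanOn, intervalIntegral.integral_of_le hab, intervalIntegral.integral_of_le hab]
  congr 1
  exact (setIntegral_congr_ae measurableSet_Ioc (by
    filter_upwards [(ae_restrict_iff' measurableSet_Ioc).1 h] with r hr hr'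
    exact hr (Ioc_subset_Ioc ha hb hr'))).symm

/-- A function whose increments are bounded above and below by those of functions which are almost
differentiable with the same derivative is differentiable. -/
theorem hasDerivAt_of_slope_squeeze {y : ℝ → ℝ} {U W : ℕ → ℝ → ℝ} {u w : ℕ → ℝ} {t α : ℝ}
    {s : Set ℝ} (hs : s ∈ 𝓝 t)
    (hU : ∀ N, HasDerivAt (U N) (u N) t) (hW : ∀ N, HasDerivAt (W N) (w N) t)
    (hu : ∀ ε > 0, ∃ N, u N < α + ε) (hw : ∀ ε > 0, ∃ N, w N < -α + ε)
    (hyU : ∀ N, ∀ a ∈ s, ∀ b ∈ s, a ≤ b → y b - y a ≤ U N b - U N a)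
    (hyW : ∀ N, ∀ a ∈ s, ∀ b ∈ s, a ≤ b → y a - y b ≤ W N b - W N a) : HasDerivAt y α t := by
  have hts := mem_of_mem_nhds hs
  have key : ∀ {x V : ℝ → ℝ}, (∀ a ∈ s, ∀ b ∈ s, a ≤ b → x b - x a ≤ V b - V a) →
      ∀ᶠ r in 𝓝[≠] t, slope x t r ≤ slope V t r := by
    intro x V hxV
    filter_upwards [self_mem_nhdsWithin, nhdsWithin_le_nhds hs] with r hr hrs
    rw [slope_def_field, slope_def_field]
    rcases lt_or_gt_of_ne hr with h | h
    · rw [← neg_sub (x t), ← neg_sub (V t), ← neg_sub t, neg_div_neg_eq, neg_div_neg_eq]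
      exact div_le_div_of_nonneg_right (hxV r hrs t hts h.le) (sub_nonneg.2 h.le)
    · exact div_le_div_of_nonneg_right (hxV t hts r hrs h.le) (sub_nonneg.2 h.le)
  rw [hasDerivAt_iff_tendsto_slope, tendsto_order]
  constructor
  · intro β hβ
    obtain ⟨N, hN⟩ := hw (α - β) (sub_pos.2 hβ)
    filter_upwards [key (x := fun r => -y r) (V := W N) (fun a ha b hb hab => by
      have := hyW N a ha b hb hab
      linarith), (hasDerivAt_iff_tendsto_slope.1 (hW N)).eventually (gt_mem_nhds hN)] with r h1 h2
    have h3 : slope (fun r => -y r) t r = -slope y t r := by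
      rw [slope_def_field, slope_def_field]
      ring
    rw [h3] at h1
    linarith
  · intro β hβ
    obtain ⟨N, hN⟩ := hu (β - α) (sub_pos.2 hβ)
    filter_upwards [key (hyU N), (hasDerivAt_iff_tendsto_slope.1 (hU N)).eventually
      (gt_mem_nhds hN)] with r h1 h2
    linarith

namespace FirstVariation

variable {T : ℝ} {p : ℝ → E} {k : ℝ → ℝ} {Θ : ℕ → ℝ → E → ℝ} {ψ : ℕ → E → ℝ} {L : ℝ}

/-- Trapezoids with flanks `[s-h,s]` and `[t,t+h]`: as `h → 0` the integrals of `k` over the flanks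
vanish and only the plateau remains. -/
theorem inner_sub_le [CompleteSpace E] (H : FirstVariation T p k Θ ψ L) {s t : ℝ} (hs : 0 < s) (hst : s ≤ t)
    (ht : t < T) {vs vt : E} (hvs : Tendsto (fun h => meanOn p (s - h) s) (𝓝[>] 0) (𝓝 vs))
    (hvt : Tendsto (fun h => meanOn p t (t + h)) (𝓝[>] 0) (𝓝 vt)) {e : E} (he : ‖e‖ ≤ 1)
    {D : ℝ → ℝ} (hD : IntegrableOn D (Ioc 0 T)) {N : ℕ}
    (hΘ : ∀ᵐ r ∂volume.restrict (Ioc 0 T), ∀ n ≥ N, Θ n r e ≤ D r) :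
    inner ℝ (vt - vs) e ≤ ∫ r in s..t, D r := by
  have hκ : ∀ c : ℝ, Continuous fun x => ∫ r in c..x, k r := fun c =>
    intervalIntegral.continuous_primitive (fun a b => H.int_k.intervalIntegrable) c
  have h1 : Tendsto (fun h : ℝ => ∫ r in (s - h)..s, k r) (𝓝[>] 0) (𝓝 0) := by
    have : Continuous fun h : ℝ => ∫ r in (s - h)..s, k r := by
      simp only [intervalIntegral.integral_symm s]
      exact ((hκ s).comp (continuous_const.sub continuous_id)).neg
    simpa using (this.tendsto 0).mono_left nhdsWithin_le_nhds
  have h2 : Tendsto (fun h : ℝ => ∫ r in t..(t + h), k r) (𝓝[>] 0) (𝓝 0) := by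
    have : Continuous fun h : ℝ => ∫ r in t..(t + h), k r :=
      (hκ t).comp (continuous_const.add continuous_id)
    simpa using (this.tendsto 0).mono_left nhdsWithin_le_nhds
  have h3 := (h1.add (tendsto_const_nhds (x := ∫ r in s..t, D r))).add h2
  rw [zero_add, add_zero] at h3
  refine le_of_tendsto_of_tendsto ((hvt.sub hvs).inner tendsto_const_nhds) h3 ?_
  filter_upwards [self_mem_nhdsWithin, nhdsWithin_le_nhds (gt_mem_nhds hs),
    nhdsWithin_le_nhds (gt_mem_nhds (sub_pos.2 ht))] with h hh hhs hht
  have hh' : 0 < h := hh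
  exact H.inner_meanOn_sub_le (by linarith) (by linarith) hst (by linarith) (by linarith) he hD hΘ

theorem le_k (H : FirstVariation T p k Θ ψ L) {e : E} (he : ‖e‖ ≤ 1) :
    ∀ᵐ r ∂volume.restrict (Ioc 0 T), ∀ n ≥ 0, Θ n r e ≤ k r := by
  filter_upwards [H.bound] with r hr n _
  exact (le_abs_self _).trans ((hr n e he).trans (mul_le_of_le_one_right (H.k_nonneg r) he))

/-- The velocity part of the variation has an absolutely continuous representative. -/
theorem exists_continuous_ae_eq [CompleteSpace E] [FiniteDimensional ℝ E] (H : FirstVariation T p k Θ ψ L) :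
    ∃ z : ℝ → E, Continuous z ∧ AbsolutelyContinuousOnInterval z 0 T ∧
      z =ᵐ[volume.restrict (Ioc 0 T)] p := by
  set κ : ℝ → ℝ := fun x => ∫ r in (0 : ℝ)..x, k r with hκ
  have hki : ∀ a b, IntervalIntegrable k volume a b := fun a b => H.int_k.intervalIntegrable
  have hκc : Continuous κ := intervalIntegral.continuous_primitive hki 0
  set S : Set ℝ := {t | t ∈ Ioo 0 T ∧ HasDerivAt (fun x => ∫ r in (0 : ℝ)..x, p r) (p t) t}
  have hpi : ∀ a b, IntervalIntegrable p volume a b := fun a b => H.int_p.intervalIntegrable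
  have hSle : ∀ s ∈ S, ∀ t ∈ S, s ≤ t → ‖p t - p s‖ ≤ κ t - κ s := by
    intro s hs t ht hst
    refine norm_le_of_forall_inner_le fun e he => ?_
    have := H.inner_sub_le hs.1.1 hst ht.1.2 (tendsto_meanOn_left hpi hs.2)
      (tendsto_meanOn_right hpi ht.2) he H.int_k.integrableOn (H.le_k he)
    rwa [hκ, intervalIntegral.integral_interval_sub_left (hki _ _) (hki _ _)]
  have hSabs : ∀ s ∈ S, ∀ t ∈ S, ‖p t - p s‖ ≤ |κ t - κ s| := by
    intro s hs t ht
    rcases le_total s t with h | h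
    · exact (hSle s hs t ht h).trans (le_abs_self _)
    · rw [norm_sub_rev, abs_sub_comm]
      exact (hSle t ht s hs h).trans (le_abs_self _)
  -- On the full measure set `S` of differentiation points, `p` depends only on `κ`, and in a
  -- 1-Lipschitz way. Extending this function from `κ '' S` to the line and composing with the
  -- absolutely continuous `κ` gives the representative.
  set f : ℝ → E := fun y => p (Function.invFunOn κ S y) with hf
  have hinv : ∀ y ∈ κ '' S, Function.invFunOn κ S y ∈ S ∧ κ (Function.invFunOn κ S y) = y :=
    fun y hy => ⟨Function.invFunOn_mem hy, Function.invFunOn_eq hy⟩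
  have hfL : LipschitzOnWith 1 f (κ '' S) := by
    refine LipschitzOnWith.of_dist_le_mul fun x hx y hy => ?_
    obtain ⟨hx1, hx2⟩ := hinv x hx
    obtain ⟨hy1, hy2⟩ := hinv y hy
    have := hSabs _ hy1 _ hx1
    rw [hx2, hy2] at this
    simpa [dist_eq_norm, hf] using this
  obtain ⟨q, hq, hqf⟩ := hfL.extend_finite_dimension
  refine ⟨q ∘ κ, hq.continuous.comp hκc, ?_, ?_⟩
  · have hκa : AbsolutelyContinuousOnInterval κ 0 T :=
      (hki 0 T).absolutelyContinuousOnInterval_intervalIntegral (by simp)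
    have h0 := hκa.const_mul (lipschitzExtensionConstant E * 1 : ℝ≥0)
    refine squeeze_zero (fun _ => Finset.sum_nonneg fun _ _ => dist_nonneg) (fun F => ?_) h0
    refine Finset.sum_le_sum fun i _ => ?_
    refine (hq.dist_le_mul _ _).trans_eq ?_
    rw [Real.dist_eq, Real.dist_eq, ← mul_sub, abs_mul, NNReal.abs_eq]
  · have h1 := LocallyIntegrable.ae_hasDerivAt_integral H.int_p.locallyIntegrable
    filter_upwards [ae_restrict_of_ae h1, ae_restrict_Ioo_mem] with t ht htT
    have htS : t ∈ S := ⟨htT, ht 0⟩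
    have hmem : κ t ∈ κ '' S := mem_image_of_mem κ htS
    obtain ⟨h2, h3⟩ := hinv _ hmem
    have h4 := hSabs _ h2 _ htS
    rw [h3, sub_self, abs_zero] at h4
    rw [Function.comp, ← hqf hmem, hf]
    exact (sub_eq_zero.1 (norm_le_zero_iff.1 h4)).symm

section Representative

variable {z : ℝ → E}

theorem tendsto_left [CompleteSpace E] (hz : Continuous z) (hzp : z =ᵐ[volume.restrict (Ioc 0 T)] p) {t : ℝ}
    (ht : t ∈ Ioc 0 T) : Tendsto (fun h => meanOn p (t - h) t) (𝓝[>] 0) (𝓝 (z t)) := by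
  refine (tendsto_meanOn_left (fun a b => hz.intervalIntegrable a b)
    (hz.integral_hasStrictDerivAt 0 t).hasDerivAt).congr' ?_
  filter_upwards [self_mem_nhdsWithin, nhdsWithin_le_nhds (gt_mem_nhds ht.1)] with h hh hht
  have hh' : 0 < h := hh
  exact (meanOn_congr hzp (by linarith) (by linarith) ht.2).symm

theorem tendsto_right [CompleteSpace E] (hz : Continuous z) (hzp : z =ᵐ[volume.restrict (Ioc 0 T)] p) {t : ℝ}
    (ht : t ∈ Ico 0 T) : Tendsto (fun h => meanOn p t (t + h)) (𝓝[>] 0) (𝓝 (z t)) := by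
  refine (tendsto_meanOn_right (fun a b => hz.intervalIntegrable a b)
    (hz.integral_hasStrictDerivAt 0 t).hasDerivAt).congr' ?_
  filter_upwards [self_mem_nhdsWithin, nhdsWithin_le_nhds (gt_mem_nhds (sub_pos.2 ht.2))]
    with h hh hht
  have hh' : 0 < h := hh
  exact (meanOn_congr hzp ht.1 (by linarith) (by linarith)).symm

/-- A steep ramp ending at `t`, followed by the plateau `e` up to `T`, balances `z t` against at
most all of `∫ k` and the Lipschitz constant of the final cost. -/
theorem norm_le [CompleteSpace E] (H : FirstVariation T p k Θ ψ L) (hL : 0 ≤ L) (hz : Continuous z)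
    (hzp : z =ᵐ[volume.restrict (Ioc 0 T)] p) {t : ℝ} (ht : t ∈ Icc 0 T) :
    ‖z t‖ ≤ L + ∫ r in Ioc 0 T, k r := by
  have key : ∀ t ∈ Ioc 0 T, ‖z t‖ ≤ L + ∫ r in Ioc 0 T, k r := by
    intro t ht
    rw [← norm_neg]
    refine norm_le_of_forall_inner_le fun e he => ?_
    refine le_of_tendsto ((tendsto_left hz hzp ht).neg.inner (tendsto_const_nhds (x := e))) ?_
    filter_upwards [self_mem_nhdsWithin, nhdsWithin_le_nhds (gt_mem_nhds ht.1)] with h hh hht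
    have hh' : 0 < h := hh
    have h1 := H.inner_meanOn_nonneg (a := t - h) (b := t) (by linarith) (by linarith) ht.2 he
      (c := L) (Eventually.of_forall fun n => (le_abs_self _).trans
        ((H.bound_final n e).trans (mul_le_of_le_one_right hL he)))
    have h2 : ∫ r in (t - h)..T, k r ≤ ∫ r in Ioc 0 T, k r := by
      rw [intervalIntegral.integral_of_le (by linarith [ht.2])]
      exact setIntegral_mono_set H.int_k.integrableOn (ae_of_all _ H.k_nonneg)
        (Ioc_subset_Ioc_left (by linarith)).eventuallyLE
    rw [inner_neg_left]
    linarith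
  -- At time zero there is no room for a ramp on the left, so the bound is obtained there by
  -- continuity.
  rcases ht.1.eq_or_lt with rfl | h0
  · have hc : Tendsto (fun t => ‖z t‖) (𝓝[>] 0) (𝓝 ‖z 0‖) :=
      (hz.norm.tendsto 0).mono_left nhdsWithin_le_nhds
    refine le_of_tendsto hc ?_
    filter_upwards [self_mem_nhdsWithin, nhdsWithin_le_nhds (gt_mem_nhds H.pos)] with t h1 h2
    exact key t ⟨h1, h2.le⟩
  · exact key t ⟨h0, ht.2⟩

/-- Ramps concentrated at `T` eliminate the integral of `k` and leave `0 ≤ ⟨z(T) + w, e⟩` for every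
`e` in the unit ball, which forces `z(T) + w = 0`. -/
theorem eq_neg_of_tendsto [CompleteSpace E] (H : FirstVariation T p k Θ ψ L) (hz : Continuous z)
    (hzp : z =ᵐ[volume.restrict (Ioc 0 T)] p) {w : E}
    (hw : ∀ e, Tendsto (fun n => ψ n e) atTop (𝓝 (inner ℝ w e))) : z T = -w := by
  have h0 : ∀ e : E, ‖e‖ ≤ 1 → inner ℝ (-(z T + w)) e ≤ 0 := by
    intro e he
    refine le_of_forall_pos_le_add fun ε hε => ?_
    have hκ : Tendsto (fun h : ℝ => ∫ r in (T - h)..T, k r) (𝓝[>] 0) (𝓝 0) := by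
      have : Continuous fun h : ℝ => ∫ r in (T - h)..T, k r := by
        simp only [intervalIntegral.integral_symm T]
        exact ((intervalIntegral.continuous_primitive
          (fun a b => H.int_k.intervalIntegrable) T).comp (continuous_const.sub continuous_id)).neg
      simpa using (this.tendsto 0).mono_left nhdsWithin_le_nhds
    have h1 := (((tendsto_left hz hzp (right_mem_Ioc.2 H.pos)).inner
      (tendsto_const_nhds (x := e))).add hκ).add_const (inner ℝ w e + ε)
    have h2 : 0 ≤ inner ℝ (z T) e + 0 + (inner ℝ w e + ε) := by
      refine ge_of_tendsto h1 ?_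
      filter_upwards [self_mem_nhdsWithin, nhdsWithin_le_nhds (gt_mem_nhds H.pos)] with h hh hhT
      have hh' : 0 < h := hh
      exact H.inner_meanOn_nonneg (by linarith) (by linarith) le_rfl he
        ((hw e).eventually (ge_mem_nhds (by linarith)))
    rw [inner_neg_left, inner_add_left]
    linarith
  have h1 := norm_le_of_forall_inner_le h0
  rw [norm_neg, norm_le_zero_iff] at h1
  exact eq_neg_of_add_eq_zero_left h1

/-- These tail suprema serve as the plateau bound `D` in `inner_sub_le`. At a time where the
quotients converge they come arbitrarily close to the limit as `N` grows, and `k` keeps them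
integrable. -/
theorem exists_iSup_bound (H : FirstVariation T p k Θ ψ L) {e : E} (he : ‖e‖ ≤ 1) (N : ℕ) :
    IntegrableOn (fun r => ⨆ n, Θ (N + n) r e) (Ioc 0 T) ∧
    ∀ᵐ r ∂volume.restrict (Ioc 0 T), ∀ n ≥ N, Θ n r e ≤ ⨆ n, Θ (N + n) r e := by
  have hb : ∀ᵐ r ∂volume.restrict (Ioc 0 T), ∀ n, |Θ n r e| ≤ k r := by
    filter_upwards [H.bound] with r hr n
    exact (hr n e he).trans (mul_le_of_le_one_right (H.k_nonneg r) he)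
  constructor
  · refine H.int_k.integrableOn.mono' (AEMeasurable.iSup fun n =>
      (H.meas (N + n) (fun _ => e) continuous_const).aemeasurable).aestronglyMeasurable ?_
    filter_upwards [hb] with r hr
    rw [Real.norm_eq_abs, abs_le]
    refine ⟨(abs_le.1 (hr N)).1.trans ?_, ciSup_le fun n => (abs_le.1 (hr _)).2⟩
    exact le_ciSup (f := fun n => Θ (N + n) r e) ⟨k r, by
      rintro _ ⟨n, rfl⟩
      exact (abs_le.1 (hr _)).2⟩ 0
  · filter_upwards [hb] with r hr n hn
    have := le_ciSup (f := fun n => Θ (N + n) r e) ⟨k r, by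
      rintro _ ⟨n, rfl⟩
      exact (abs_le.1 (hr _)).2⟩ (n - N)
    simpa [Nat.add_sub_cancel' hn] using this

/-- Increments of `⟨z, e⟩` lie below those of the primitives of the tail suprema; using `e` and `-e`
squeezes the slopes wherever the quotients converge. Only basis vectors, their negatives and
countably many `N` are used, so a single null set serves for all `f`. -/
theorem ae_hasDerivAt [CompleteSpace E] [FiniteDimensional ℝ E] (H : FirstVariation T p k Θ ψ L) (hz : Continuous z)
    (hzp : z =ᵐ[volume.restrict (Ioc 0 T)] p) :
    ∀ᵐ t ∂volume.restrict (Ioc 0 T), ∀ f : E,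
      (∀ e, Tendsto (fun n => Θ n t e) atTop (𝓝 (inner ℝ f e))) → HasDerivAt z f t := by
  set b := stdOrthonormalBasis ℝ E
  have hb : ∀ i, ‖b i‖ ≤ 1 := fun i => (b.norm_eq_one i).le
  have hb' : ∀ i, ‖-b i‖ ≤ 1 := fun i => by rw [norm_neg]; exact hb i
  have hT := H.pos
  have key : ∀ e : E, ‖e‖ ≤ 1 → ∀ᵐ t ∂volume.restrict (Ioc 0 T), ∀ N,
      HasDerivAt (fun x => ∫ r in (0 : ℝ)..x, ⨆ n, Θ (N + n) r e) (⨆ n, Θ (N + n) t e) t := by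
    intro e he
    rw [ae_all_iff]
    intro N
    have h1 := ((intervalIntegrable_iff_integrableOn_Ioc_of_le hT.le).2
      (H.exists_iSup_bound he N).1).ae_hasDerivAt_integral
    filter_upwards [ae_restrict_of_ae h1, ae_restrict_Ioo_mem] with t ht htT
    exact ht (by rw [uIcc_of_le hT.le]; exact Ioo_subset_Icc_self htT) 0 (by simp)
  have hle : ∀ e : E, ‖e‖ ≤ 1 → ∀ N, ∀ s ∈ Ioo 0 T, ∀ t ∈ Ioo 0 T, s ≤ t →
      inner ℝ (z t - z s) e ≤ (∫ r in (0 : ℝ)..t, ⨆ n, Θ (N + n) r e) -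
        ∫ r in (0 : ℝ)..s, ⨆ n, Θ (N + n) r e := by
    intro e he N s hs t ht hst
    obtain ⟨h1, h2⟩ := H.exists_iSup_bound he N
    have hi : ∀ x ∈ Ioo 0 T, IntervalIntegrable (fun r => ⨆ n, Θ (N + n) r e) volume 0 x :=
      fun x hx => (intervalIntegrable_iff_integrableOn_Ioc_of_le hx.1.le).2
        (h1.mono_set (Ioc_subset_Ioc_right hx.2.le))
    rw [intervalIntegral.integral_interval_sub_left (hi t ht) (hi s hs)]
    exact H.inner_sub_le hs.1 hst ht.2 (tendsto_left hz hzp (Ioo_subset_Ioc_self hs))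
      (tendsto_right hz hzp (Ioo_subset_Ico_self ht)) he h1 h2
  have hsup : ∀ (t : ℝ) (e : E) (α : ℝ), Tendsto (fun n => Θ n t e) atTop (𝓝 α) →
      ∀ ε > 0, ∃ N, ⨆ n, Θ (N + n) t e < α + ε := by
    intro t e α h ε hε
    obtain ⟨N, hN⟩ := eventually_atTop.1 (h.eventually (ge_mem_nhds (show α < α + ε / 2 by linarith)))
    exact ⟨N, (ciSup_le fun n => hN (N + n) (Nat.le_add_right _ _)).trans_lt (by linarith)⟩
  have k1 := ae_all_iff.2 fun i => key (b i) (hb i)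
  have k2 := ae_all_iff.2 fun i => key (-b i) (hb' i)
  filter_upwards [k1, k2, ae_restrict_Ioo_mem] with t h1 h2 htT f hf
  have hi : ∀ i, HasDerivAt (fun r => inner ℝ (b i) (z r)) (inner ℝ (b i) f) t := by
    intro i
    refine hasDerivAt_of_slope_squeeze (Ioo_mem_nhds htT.1 htT.2) (h1 i) (h2 i)
      (hsup t _ _ (by rw [real_inner_comm]; exact hf (b i)))
      (hsup t _ _ (by rw [real_inner_comm, ← inner_neg_right]; exact hf (-b i))) ?_ ?_
    · intro N x hx y hy hxy
      have := hle (b i) (hb i) N x hx y hy hxy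
      rwa [real_inner_comm, inner_sub_right] at this
    · intro N x hx y hy hxy
      have := hle (-b i) (hb' i) N x hx y hy hxy
      rw [real_inner_comm, inner_sub_right, inner_neg_left, inner_neg_left] at this
      linarith
  have hsum : HasDerivAt (fun r => ∑ i, inner ℝ (b i) (z r) • b i) (∑ i, inner ℝ (b i) f • b i) t :=
    HasDerivAt.fun_sum fun i _ => (hi i).smul_const (b i)
  simpa only [b.sum_repr'] using hsum

end Representative

end FirstVariation

end Momentum

/-! ### Energy estimates for equilibria and optimal curves. -/

namespace Game

variable {d : ℕ} {Λ : AddSubgroup (Euc d)} {G : Game Λ}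

/-- The assumptions on an equilibrium, with names for the constants in them. -/
structure Standing (G : Game Λ) (Q : Measure G.Path) (ρ C B : ℝ) (L : ℝ≥0) : Prop where
  sep : IsSeparated Λ ρ
  η_pos : ∀ x, 0 < G.η x
  C_nonneg : 0 ≤ C
  growth : ∀ x v, G.η (x + toDom Λ v) ≤ Real.exp (C * ‖v‖) * G.η x
  bound : ∀ x, G.η x ≤ B
  lip : LipschitzWith L G.Ψ
  neg_part : ∫⁻ x, ENNReal.ofReal (-G.Ψ x) ∂G.m₀ < ⊤
  equi : G.IsEquilibrium Q

/-- The position of a curve at the time `r`, for `r ∈ ℝ`. -/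
noncomputable def pos (G : Game Λ) (γ : G.Path) (r : ℝ) : Dom Λ := γ (projIcc 0 G.T G.T_pos.le r)

/-- The measurable version of the velocity of a curve. -/
noncomputable def vel (G : Game Λ) (ρ : ℝ) (γ : G.Path) (r : ℝ) : Euc d :=
  velocity' ρ G.T_pos.le γ r

theorem measurable_comp_pos_sub {f : Dom Λ → ℝ} (hf : Continuous f) {y : ℝ → Dom Λ}
    (hy : Continuous y) : Measurable fun q : ℝ × G.Path => f (y q.1 - G.pos q.2 q.1) := by
  have h1 : Continuous fun q : ℝ × G.Path => G.pos q.2 q.1 :=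
    continuous_curve_eval.comp
      (continuous_snd.prodMk ((continuous_projIcc (h := G.T_pos.le)).comp continuous_fst))
  exact (hf.comp ((hy.comp continuous_fst).sub h1)).measurable

theorem continuous_pos (γ : G.Path) : Continuous (G.pos γ) :=
  γ.continuous.comp continuous_projIcc

namespace Standing

variable {Q : Measure G.Path} {ρ C B : ℝ} {L : ℝ≥0}

theorem measurable_vel (S : G.Standing Q ρ C B L) :
    Measurable fun q : ℝ × G.Path => G.vel ρ q.2 q.1 := by
  have h := (S.sep.measurable_velocity' G.T_pos.le).comp
    (measurable_swap (α := ℝ) (β := Curve Λ G.T))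
  exact h

theorem B_pos (S : G.Standing Q ρ C B L) : 0 < B := (S.η_pos 0).trans_le (S.bound 0)

theorem isWeakDeriv (S : G.Standing Q ρ C B L) {γ : G.Path} (hγ : IsH1 γ) :
    IsWeakDeriv γ (G.vel ρ γ) := hγ.isWeakDeriv S.sep G.T_pos

theorem kinetic_eq_top_or (S : G.Standing Q ρ C B L) (γ : G.Path) :
    kinetic γ = ⊤ ∨ (IsH1 γ ∧ kinetic γ < ⊤) := by
  by_cases h : IsH1 γ
  · refine Or.inr ⟨h, ?_⟩
    rw [(S.isWeakDeriv h).kinetic_eq S.sep G.T_pos]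
    exact ENNReal.mul_lt_top (by simp) (S.isWeakDeriv h).lintegral_lt_top
  · exact Or.inl (by rw [kinetic, if_neg h])

theorem integrable_norm_sq {T : ℝ} {γ : Curve Λ T} {f : ℝ → Euc d} (hf : IsWeakDeriv γ f) :
    IntegrableOn (fun r => ‖f r‖ ^ 2) (Ioc 0 T) := hf.1.integrable_norm_pow two_ne_zero

theorem toReal_kinetic (S : G.Standing Q ρ C B L) {γ : G.Path} {f : ℝ → Euc d}
    (hf : IsWeakDeriv γ f) : (kinetic γ).toReal = 2⁻¹ * ∫ r in Ioc 0 G.T, ‖f r‖ ^ 2 := by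
  rw [hf.kinetic_eq S.sep G.T_pos, ENNReal.toReal_mul, integral_eq_lintegral_of_nonneg_ae
    (ae_of_all _ fun _ => by positivity) (integrable_norm_sq hf).aestronglyMeasurable]
  congr 2
  · simp
  · simp [ENNReal.ofReal_pow, ofReal_norm]

/-- The variation of the final cost is controlled by half of the kinetic energy. -/
theorem final_cost_le (S : G.Standing Q ρ C B L) {γ : G.Path} (hγ : IsH1 γ) :
    G.Ψ (γ G.t₀) - G.Ψ (γ G.t₁) ≤ G.δ / 2 * (kinetic γ).toReal + G.T * (L ^ 2 / G.δ) := by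
  have hw := S.isWeakDeriv hγ
  have h1 : G.Ψ (γ G.t₀) - G.Ψ (γ G.t₁) ≤ L * ‖γ G.t₁ - γ G.t₀‖ := by
    have := S.lip.dist_le_mul (γ G.t₀) (γ G.t₁)
    rw [Real.dist_eq, dist_comm, dist_eq_norm] at this
    exact (le_abs_self _).trans this
  have h2 := hw.norm_sub_le G.t₀ G.t₁
  -- Young's inequality, with the weight `δ/4` on the squared speed: it spends exactly half of `δ
  -- K(γ)`.
  have h3 : L * ∫ r in Ioc 0 G.T, ‖G.vel ρ γ r‖ ≤
      ∫ r in Ioc 0 G.T, (G.δ / 4 * ‖G.vel ρ γ r‖ ^ 2 + L ^ 2 / G.δ) := by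
    rw [← integral_const_mul]
    refine integral_mono ((hw.1.integrable one_le_two).norm.const_mul _)
      (((integrable_norm_sq hw).const_mul _).add (integrable_const _)) fun r => ?_
    have hδ := G.δ_pos
    have : G.δ / 4 * ‖G.vel ρ γ r‖ ^ 2 + L ^ 2 / G.δ - L * ‖G.vel ρ γ r‖ =
        (G.δ * ‖G.vel ρ γ r‖ / 2 - L) ^ 2 / G.δ := by
      field_simp
      ring
    have h0 : 0 ≤ (G.δ * ‖G.vel ρ γ r‖ / 2 - L) ^ 2 / G.δ := by positivity
    simp only
    linarith
  rw [integral_add ((integrable_norm_sq hw).const_mul _) (integrable_const _), integral_const_mul,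
    integral_const, measureReal_restrict_apply_univ, Real.volume_real_Ioc_of_le G.T_pos.le, sub_zero,
    smul_eq_mul] at h3
  rw [S.toReal_kinetic hw]
  have h4 := mul_le_mul_of_nonneg_left h2 L.2
  have h5 : L * ‖γ G.t₁ - γ G.t₀‖ ≤ L * ∫ r in Ioc 0 G.T, ‖G.vel ρ γ r‖ := h4
  linarith

/-- By `final_cost_le`, half of `δ K(γ)` pays for moving the final cost from `γ(T)` back to `γ(0)`;
there its negative part is governed by `m₀`, since the initial point has law `m₀` under `Q`. -/
theorem ofReal_mul_kinetic_le (S : G.Standing Q ρ C B L) (γ : G.Path) :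
    ENNReal.ofReal (G.δ / 2) * kinetic γ ≤ (G.cost γ Q).toENNReal +
      (ENNReal.ofReal (-G.Ψ (γ G.t₀)) + ENNReal.ofReal (G.T * (L ^ 2 / G.δ))) := by
  have hδ := G.δ_pos
  rcases S.kinetic_eq_top_or γ with h | ⟨hγ, h⟩
  · have : G.cost γ Q = ⊤ := by
      rw [cost, h, ENNReal.mul_top (by simpa using hδ), top_add, EReal.coe_ennreal_top,
        EReal.top_add_coe]
    rw [this, EReal.toENNReal_top, top_add]
    exact le_top
  · have h1 : ((G.δ * (kinetic γ).toReal + G.Ψ (γ G.t₁) : ℝ) : EReal) ≤ G.cost γ Q := by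
      rw [cost, EReal.coe_add]
      gcongr
      have : ((G.δ * (kinetic γ).toReal : ℝ) : EReal) =
          ((ENNReal.ofReal G.δ * kinetic γ : ℝ≥0∞) : EReal) := by
        rw [← ENNReal.ofReal_toReal (ENNReal.mul_ne_top ENNReal.ofReal_ne_top h.ne),
          EReal.coe_ennreal_ofReal, max_eq_left ENNReal.toReal_nonneg, ENNReal.toReal_mul,
          ENNReal.toReal_ofReal hδ.le]
      rw [this]
      exact_mod_cast le_self_add
    have h2 := EReal.toENNReal_le_toENNReal h1
    have h3 : ENNReal.ofReal (G.δ / 2) * kinetic γ = ENNReal.ofReal (G.δ / 2 * (kinetic γ).toReal) := by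
      rw [ENNReal.ofReal_mul (by positivity), ENNReal.ofReal_toReal h.ne]
    have h4 := S.final_cost_le hγ
    rw [h3]
    calc ENNReal.ofReal (G.δ / 2 * (kinetic γ).toReal)
        ≤ ENNReal.ofReal ((G.δ * (kinetic γ).toReal + G.Ψ (γ G.t₁)) +
            (-G.Ψ (γ G.t₀) + G.T * (L ^ 2 / G.δ))) := ENNReal.ofReal_le_ofReal (by linarith)
      _ ≤ ENNReal.ofReal (G.δ * (kinetic γ).toReal + G.Ψ (γ G.t₁)) +
            (ENNReal.ofReal (-G.Ψ (γ G.t₀)) + ENNReal.ofReal (G.T * (L ^ 2 / G.δ))) :=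
          ENNReal.ofReal_add_le.trans (add_le_add le_rfl ENNReal.ofReal_add_le)
      _ ≤ _ := add_le_add (by rwa [EReal.real_coe_toENNReal] at h2) le_rfl

theorem lintegral_kinetic_lt_top (S : G.Standing Q ρ C B L) : ∫⁻ γ, kinetic γ ∂Q < ⊤ := by
  have := S.equi.prob
  have := S.sep.isClosed
  have hδ : ENNReal.ofReal (G.δ / 2) ≠ 0 := by simpa using G.δ_pos
  have hev : Continuous fun γ : G.Path => γ G.t₀ := continuous_eval_const _
  have hΨ : Measurable fun x => ENNReal.ofReal (-G.Ψ x) := by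
    have := G.Ψ_cont.measurable
    fun_prop
  have hm : Measurable fun γ : G.Path => ENNReal.ofReal (-G.Ψ (γ G.t₀)) := hΨ.comp hev.measurable
  have h1 : ∫⁻ γ : G.Path, ENNReal.ofReal (-G.Ψ (γ G.t₀)) ∂Q < ⊤ := by
    have h := S.neg_part
    rw [← S.equi.initial, lintegral_map hΨ hev.measurable] at h
    exact h
  have hm' : Measurable fun γ : G.Path =>
      ENNReal.ofReal (-G.Ψ (γ G.t₀)) + ENNReal.ofReal (G.T * (L ^ 2 / G.δ)) :=
    hm.add measurable_const
  have h2 := lintegral_mono (μ := Q) S.ofReal_mul_kinetic_le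
  rw [lintegral_const_mul' _ _ ENNReal.ofReal_ne_top,
    lintegral_add_right _ hm', lintegral_add_right _ measurable_const, lintegral_const, measure_univ, mul_one] at h2
  have h3 := h2.trans_lt (ENNReal.add_lt_top.2 ⟨S.equi.finite_cost,
    ENNReal.add_lt_top.2 ⟨h1, ENNReal.ofReal_lt_top⟩⟩)
  exact (ENNReal.mul_lt_top_iff.1 h3).elim (fun h => h.2) fun h => h.elim (fun h => absurd h hδ)
    fun h => by simp [h]

/-- A curve at rest has zero velocity, so only the players' own kinetic energy, weighted by `η ≤ B`,
remains. This makes resting curves uniformly good competitors. -/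
theorem interaction_const_le (S : G.Standing Q ρ C B L) (x : Dom Λ) (ω : G.Path) :
    interaction G.η (ContinuousMap.const (Icc 0 G.T) x) ω ≤ ENNReal.ofReal B * kinetic ω := by
  rcases S.kinetic_eq_top_or ω with h | ⟨hω, h⟩
  · rw [h, ENNReal.mul_top (by simpa using S.B_pos)]
    exact le_top
  · have hw := S.isWeakDeriv hω
    rw [(isWeakDeriv_const x).interaction_eq S.sep G.T_pos G.η hw, hw.kinetic_eq S.sep G.T_pos,
      mul_left_comm, ← lintegral_const_mul' _ _ ENNReal.ofReal_ne_top]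
    refine mul_le_mul_right (lintegral_mono fun r => ?_) _
    rw [mul_comm (ENNReal.ofReal B), Pi.zero_apply, zero_sub, enorm_neg]
    exact mul_le_mul_right (ENNReal.ofReal_le_ofReal (S.bound _)) _

theorem meanInteraction_const_le (S : G.Standing Q ρ C B L) (x : Dom Λ) :
    G.meanInteraction Q (ContinuousMap.const (Icc 0 G.T) x) ≤ ENNReal.ofReal B * ∫⁻ γ, kinetic γ ∂Q := by
  rw [← lintegral_const_mul' _ _ ENNReal.ofReal_ne_top]
  exact lintegral_mono (S.interaction_const_le x)

/-- Optimal curves have finite cost, and the interaction parts of the costs are bounded. -/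
theorem optimal_bound (S : G.Standing Q ρ C B L) {γ : G.Path} (hγ : G.IsOptimal γ Q) :
    IsH1 γ ∧ kinetic γ < ⊤ ∧ G.meanInteraction Q γ < ⊤ ∧
      G.lam * (G.meanInteraction Q γ).toReal ≤
        G.lam * (B * (∫⁻ γ, kinetic γ ∂Q).toReal) + G.T * (L ^ 2 / G.δ) := by
  have hδ := G.δ_pos
  have hlam := G.lam_pos
  set I := (∫⁻ γ, kinetic γ ∂Q) with hI
  have hItop : I < ⊤ := S.lintegral_kinetic_lt_top
  -- The competitor stays at the initial point of `γ`. The difference `Ψ(γ(0)) - Ψ(γ(T))` left in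
  -- the comparison is absorbed by half of the kinetic term, so the final bound does not depend on
  -- `γ`.
  have h1 : G.cost γ Q ≤ G.cost (ContinuousMap.const (Icc 0 G.T) (γ G.t₀)) Q := by
    have h := hγ
    rw [IsOptimal] at h
    rw [h]
    exact iInf₂_le (f := fun (ω : G.Path) (_ : ω G.t₀ = γ G.t₀) => G.cost ω Q) (ContinuousMap.const (Icc 0 G.T) (γ G.t₀)) rfl
  have hk0 : kinetic (ContinuousMap.const (Icc 0 G.T) (γ G.t₀)) = 0 := by
    rw [(isWeakDeriv_const (γ G.t₀)).kinetic_eq S.sep G.T_pos]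
    simp
  have h2 : G.cost (ContinuousMap.const (Icc 0 G.T) (γ G.t₀)) Q ≤
      ((G.lam * (B * I.toReal) + G.Ψ (γ G.t₀) : ℝ) : EReal) := by
    rw [cost, hk0, mul_zero, zero_add, EReal.coe_add]
    gcongr
    · have : ((G.lam * (B * I.toReal) : ℝ) : EReal) =
          ((ENNReal.ofReal G.lam * (ENNReal.ofReal B * I) : ℝ≥0∞) : EReal) := by
        rw [← ENNReal.ofReal_toReal (a := ENNReal.ofReal G.lam * (ENNReal.ofReal B * I))
          (ENNReal.mul_ne_top ENNReal.ofReal_ne_top (ENNReal.mul_ne_top ENNReal.ofReal_ne_top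
          hItop.ne)), EReal.coe_ennreal_ofReal, max_eq_left ENNReal.toReal_nonneg,
          ENNReal.toReal_mul, ENNReal.toReal_mul, ENNReal.toReal_ofReal hlam.le,
          ENNReal.toReal_ofReal S.B_pos.le]
      rw [this]
      exact EReal.coe_ennreal_le_coe_ennreal_iff.2
        (mul_le_mul_right (S.meanInteraction_const_le _) _)
    · exact le_rfl
  have h3 := h1.trans h2
  have hfin : ENNReal.ofReal G.δ * kinetic γ + ENNReal.ofReal G.lam * G.meanInteraction Q γ ≠ ⊤ := by
    intro htop
    rw [cost, htop, EReal.coe_ennreal_top, EReal.top_add_coe] at h3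
    exact absurd h3 (not_le.2 (EReal.coe_lt_top _))
  have hfin' := ENNReal.add_ne_top.1 hfin
  have hk : kinetic γ < ⊤ := by
    rcases ENNReal.mul_lt_top_iff.1 hfin'.1.lt_top with h | h | h
    · exact h.2
    · exact absurd h (by simpa using hδ)
    · simp [h]
  have hm : G.meanInteraction Q γ < ⊤ := by
    rcases ENNReal.mul_lt_top_iff.1 hfin'.2.lt_top with h | h | h
    · exact h.2
    · exact absurd h (by simpa using hlam)
    · simp [h]
  have hH1 : IsH1 γ := isH1_of_kinetic_ne_top hk.ne
  refine ⟨hH1, hk, hm, ?_⟩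
  rw [cost, ← ENNReal.ofReal_toReal hfin, EReal.coe_ennreal_ofReal,
    max_eq_left ENNReal.toReal_nonneg, ← EReal.coe_add, EReal.coe_le_coe_iff,
    ENNReal.toReal_add hfin'.1 hfin'.2, ENNReal.toReal_mul, ENNReal.toReal_mul,
    ENNReal.toReal_ofReal hδ.le, ENNReal.toReal_ofReal hlam.le] at h3
  have h4 := S.final_cost_le hH1
  have h5 : 0 ≤ G.δ / 2 * (kinetic γ).toReal := by positivity
  linarith

/-- The support carries all the mass of `Q` and consists of optimal curves, which have finite
kinetic energy. -/
theorem ae_isH1 (S : G.Standing Q ρ C B L) : ∀ᵐ ω ∂Q, IsH1 ω := by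
  filter_upwards [Measure.support_mem_ae] with ω hω
  exact (S.optimal_bound (S.equi.optimal ω hω)).1

/-- At almost every time, the second moment of the velocities of the players is finite. -/
theorem ae_integrable_norm_sq (S : G.Standing Q ρ C B L) :
    ∀ᵐ r ∂volume.restrict (Ioc 0 G.T), Integrable (fun ω => ‖G.vel ρ ω r‖ ^ 2) Q := by
  have := S.equi.prob
  have hm : Measurable fun q : ℝ × G.Path => ‖G.vel ρ q.2 q.1‖ₑ ^ 2 := S.measurable_vel.enorm.pow_const 2
  have h1 : ∫⁻ r in Ioc 0 G.T, ∫⁻ ω, ‖G.vel ρ ω r‖ₑ ^ 2 ∂Q < ⊤ := by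
    rw [lintegral_lintegral_swap hm.aemeasurable]
    have h2 : ∫⁻ ω, (∫⁻ r in Ioc 0 G.T, ‖G.vel ρ ω r‖ₑ ^ 2) ∂Q = ∫⁻ ω, 2 * kinetic ω ∂Q := by
      refine lintegral_congr_ae ?_
      filter_upwards [S.ae_isH1] with ω hω
      rw [(S.isWeakDeriv hω).kinetic_eq S.sep G.T_pos, ← mul_assoc,
        ENNReal.mul_inv_cancel two_ne_zero ENNReal.ofNat_ne_top, one_mul]
    rw [h2, lintegral_const_mul' _ _ ENNReal.ofNat_ne_top]
    exact ENNReal.mul_lt_top (by simp) S.lintegral_kinetic_lt_top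
  filter_upwards [ae_lt_top (hm.lintegral_prod_right') h1.ne] with r hr
  refine ⟨((S.measurable_vel.comp measurable_prodMk_left).norm.pow_const 2).aestronglyMeasurable, ?_⟩
  rw [hasFiniteIntegral_iff_enorm]
  simpa [enorm_pow] using hr

/-- The interaction cost, as an integral over the time. -/
theorem meanInteraction_eq (S : G.Standing Q ρ C B L) {γ : G.Path} {f : ℝ → Euc d}
    (hf : IsWeakDeriv γ f) (hfm : Measurable f) :
    G.meanInteraction Q γ = ∫⁻ r in Ioc 0 G.T, 2⁻¹ * ∫⁻ ω, ‖f r - G.vel ρ ω r‖ₑ ^ 2 *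
      ENNReal.ofReal (G.η (G.pos γ r - G.pos ω r)) ∂Q := by
  have := S.equi.prob
  have hm : Measurable fun q : ℝ × G.Path => ‖f q.1 - G.vel ρ q.2 q.1‖ₑ ^ 2 *
      ENNReal.ofReal (G.η (G.pos γ q.1 - G.pos q.2 q.1)) :=
    (((hfm.comp measurable_fst).sub S.measurable_vel).enorm.pow_const 2).mul
      (measurable_comp_pos_sub G.η_cont (continuous_pos γ)).ennreal_ofReal
  rw [lintegral_const_mul' _ _ (by simp), lintegral_lintegral_swap hm.aemeasurable,
    ← lintegral_const_mul' _ _ (by simp), meanInteraction]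
  refine lintegral_congr_ae ?_
  filter_upwards [S.ae_isH1] with ω hω
  exact hf.interaction_eq S.sep G.T_pos G.η (S.isWeakDeriv hω)

end Standing

end Game

/-! ### The interaction density: expansion in velocity, relative bounds in position. -/

namespace Game

variable {d : ℕ} {Λ : AddSubgroup (Euc d)} {G : Game Λ}

/-- The point of `[0,T]` which is closest to `r`. -/
noncomputable def time (G : Game Λ) (r : ℝ) : Icc (0 : ℝ) G.T := projIcc 0 G.T G.T_pos.le r

/-- An interior time at which the velocities of the players have a finite second moment. -/
def IsGoodTime (G : Game Λ) (Q : Measure G.Path) (ρ r : ℝ) : Prop :=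
  r ∈ Ioo 0 G.T ∧ Integrable (fun ω => ‖G.vel ρ ω r‖ ^ 2) Q

/-- The density `½ ∫ |v - ω'(r)|² η(x - ω(r)) dQ(ω)` of the interaction cost. -/
noncomputable def ell (G : Game Λ) (Q : Measure G.Path) (ρ r : ℝ) (x : Dom Λ) (v : Euc d) : ℝ :=
  2⁻¹ * ∫ ω, ‖v - G.vel ρ ω r‖ ^ 2 * G.η (x - G.pos ω r) ∂Q

/-- The derivative `a (v - u)` of the density of the interaction cost in the velocity. -/
noncomputable def flux (G : Game Λ) (Q : Measure G.Path) (r : ℝ) (x : Dom Λ) (v : Euc d) : Euc d :=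
  G.a Q (G.time r) x • (v - G.u Q (G.time r) x)

theorem coe_time {r : ℝ} (hr : r ∈ Icc 0 G.T) : (G.time r : ℝ) = r := by
  rw [time, projIcc_of_mem G.T_pos.le hr]

namespace Standing

variable {Q : Measure G.Path} {ρ C B : ℝ} {L : ℝ≥0} {r : ℝ}

theorem ae_isGoodTime (S : G.Standing Q ρ C B L) :
    ∀ᵐ r ∂volume.restrict (Ioc 0 G.T), G.IsGoodTime Q ρ r := by
  filter_upwards [S.ae_integrable_norm_sq, ae_restrict_Ioo_mem] with r h1 h2 using ⟨h2, h1⟩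

theorem velocity_time (S : G.Standing Q ρ C B L) (hr : r ∈ Ioo 0 G.T) (ω : G.Path) :
    velocity ω (G.time r) = G.vel ρ ω r := by
  have h := coe_time (Ioo_subset_Icc_self hr)
  have h1 := S.sep.velocity'_eq G.T_pos ω (t := G.time r) (by rwa [h])
  rw [h] at h1
  exact h1.symm

theorem measurable_vel_at (S : G.Standing Q ρ C B L) (r : ℝ) :
    Measurable fun ω => G.vel ρ ω r := by
  have h := S.measurable_vel.comp (measurable_prodMk_left (x := r))
  exact h

theorem measurable_η_at (x : Dom Λ) (r : ℝ) : Measurable fun ω : G.Path => G.η (x - G.pos ω r) :=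
  (measurable_comp_pos_sub G.η_cont (continuous_const (y := x))).comp
    (measurable_prodMk_left (x := r))

theorem norm_η_le (S : G.Standing Q ρ C B L) (x : Dom Λ) : ‖G.η x‖ ≤ B := by
  rw [Real.norm_eq_abs, abs_of_pos (S.η_pos x)]
  exact S.bound x

theorem integrable_η (S : G.Standing Q ρ C B L) (x : Dom Λ) (r : ℝ) :
    Integrable (fun ω => G.η (x - G.pos ω r)) Q := by
  have := S.equi.prob
  exact Integrable.of_bound (measurable_η_at x r).aestronglyMeasurable B
    (ae_of_all _ fun _ => S.norm_η_le _)

theorem memLp_vel (S : G.Standing Q ρ C B L) (hr : G.IsGoodTime Q ρ r) :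
    MemLp (fun ω => G.vel ρ ω r) 2 Q :=
  (memLp_two_iff_integrable_sq_norm (S.measurable_vel_at r).aestronglyMeasurable).2 hr.2

theorem integrable_sq_sub (S : G.Standing Q ρ C B L) (hr : G.IsGoodTime Q ρ r) (v : Euc d) :
    Integrable (fun ω => ‖v - G.vel ρ ω r‖ ^ 2) Q := by
  have := S.equi.prob
  exact ((memLp_const v).sub (S.memLp_vel hr)).integrable_norm_pow two_ne_zero

theorem integrable_sub (S : G.Standing Q ρ C B L) (hr : G.IsGoodTime Q ρ r) (v : Euc d) :
    Integrable (fun ω => v - G.vel ρ ω r) Q := by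
  have := S.equi.prob
  exact ((memLp_const v).sub (S.memLp_vel hr)).integrable one_le_two

theorem integrable_ell (S : G.Standing Q ρ C B L) (hr : G.IsGoodTime Q ρ r) (x : Dom Λ)
    (v : Euc d) : Integrable (fun ω => ‖v - G.vel ρ ω r‖ ^ 2 * G.η (x - G.pos ω r)) Q :=
  (S.integrable_sq_sub hr v).mul_bdd (c := B) (measurable_η_at x r).aestronglyMeasurable
    (ae_of_all _ fun _ => S.norm_η_le _)

theorem integrable_smul_sub (S : G.Standing Q ρ C B L) (hr : G.IsGoodTime Q ρ r) (x : Dom Λ)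
    (v : Euc d) : Integrable (fun ω => G.η (x - G.pos ω r) • (v - G.vel ρ ω r)) Q :=
  (S.integrable_sub hr v).bdd_smul B (measurable_η_at x r).aestronglyMeasurable
    (ae_of_all _ fun _ => S.norm_η_le _)

theorem integrable_smul_vel (S : G.Standing Q ρ C B L) (hr : G.IsGoodTime Q ρ r) (x : Dom Λ) :
    Integrable (fun ω => G.η (x - G.pos ω r) • G.vel ρ ω r) Q := by
  have := S.equi.prob
  exact ((S.memLp_vel hr).integrable one_le_two).bdd_smul B
    (measurable_η_at x r).aestronglyMeasurable (ae_of_all _ fun _ => S.norm_η_le _)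

theorem a_pos (S : G.Standing Q ρ C B L) (x : Dom Λ) (r : ℝ) : 0 < G.a Q (G.time r) x := by
  have := S.equi.prob
  refine (integral_pos_iff_support_of_nonneg (fun ω => G.η_nonneg _) (S.integrable_η x r)).2 ?_
  rw [show Function.support (fun ω : G.Path => G.η (x - G.pos ω r)) = univ from
    eq_univ_of_forall fun ω => (S.η_pos _).ne', measure_univ]
  exact one_pos

theorem a_le (S : G.Standing Q ρ C B L) (x : Dom Λ) (r : ℝ) : G.a Q (G.time r) x ≤ B := by
  have := S.equi.prob
  calc G.a Q (G.time r) x ≤ ∫ _ : G.Path, B ∂Q :=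
        integral_mono (S.integrable_η x r) (integrable_const _) fun ω => S.bound _
    _ = B := by simp

theorem a_smul_u (S : G.Standing Q ρ C B L) (hr : G.IsGoodTime Q ρ r) (x : Dom Λ) :
    G.a Q (G.time r) x • G.u Q (G.time r) x = ∫ ω, G.η (x - G.pos ω r) • G.vel ρ ω r ∂Q := by
  rw [u, smul_inv_smul₀ (S.a_pos x r).ne']
  simp only [S.velocity_time hr.1]
  rfl

theorem flux_eq (S : G.Standing Q ρ C B L) (hr : G.IsGoodTime Q ρ r) (x : Dom Λ) (v : Euc d) :
    G.flux Q r x v = ∫ ω, G.η (x - G.pos ω r) • (v - G.vel ρ ω r) ∂Q := by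
  simp only [smul_sub]
  rw [integral_sub ((S.integrable_η x r).smul_const v) (S.integrable_smul_vel hr x),
    integral_smul_const, flux, smul_sub, S.a_smul_u hr]
  rfl

theorem ell_nonneg (S : G.Standing Q ρ C B L) (r : ℝ) (x : Dom Λ) (v : Euc d) :
    0 ≤ G.ell Q ρ r x v :=
  mul_nonneg (by norm_num) (integral_nonneg fun _ => mul_nonneg (sq_nonneg _) (S.η_pos _).le)

/-- The bias-variance decomposition of the interaction density. -/
theorem ell_eq (S : G.Standing Q ρ C B L) (hr : G.IsGoodTime Q ρ r) (x : Dom Λ) (v : Euc d) :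
    G.ell Q ρ r x v = 2⁻¹ * (G.a Q (G.time r) x * ‖v - G.u Q (G.time r) x‖ ^ 2 +
      G.sigma Q (G.time r) x) := by
  set u := G.u Q (G.time r) x with hu
  have hσ : G.sigma Q (G.time r) x = ∫ ω, ‖u - G.vel ρ ω r‖ ^ 2 * G.η (x - G.pos ω r) ∂Q := by
    rw [sigma]
    simp only [S.velocity_time hr.1, ← hu, norm_sub_rev u]
    rfl
  -- The cross term vanishes because `u` is the mean velocity for the weights `η(x - ω(r))`.
  have h0 : ∫ ω, inner ℝ (v - u) (G.η (x - G.pos ω r) • (u - G.vel ρ ω r)) ∂Q = 0 := by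
    rw [integral_inner (S.integrable_smul_sub hr x u), ← S.flux_eq hr, flux, ← hu, sub_self,
      smul_zero, inner_zero_right]
  have h1 : ∀ ω, ‖v - G.vel ρ ω r‖ ^ 2 * G.η (x - G.pos ω r) =
      (‖v - u‖ ^ 2 * G.η (x - G.pos ω r) +
        2 * inner ℝ (v - u) (G.η (x - G.pos ω r) • (u - G.vel ρ ω r))) +
        ‖u - G.vel ρ ω r‖ ^ 2 * G.η (x - G.pos ω r) := fun ω => by
    rw [← sub_add_sub_cancel v u, norm_add_sq_real, inner_smul_right]
    ring
  have i1 := (S.integrable_η x r).const_mul (‖v - u‖ ^ 2)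
  have i2 : Integrable (fun ω =>
      2 * inner ℝ (v - u) (G.η (x - G.pos ω r) • (u - G.vel ρ ω r))) Q :=
    ((S.integrable_smul_sub hr x u).const_inner _).const_mul 2
  have i12 : Integrable (fun ω => ‖v - u‖ ^ 2 * G.η (x - G.pos ω r) +
      2 * inner ℝ (v - u) (G.η (x - G.pos ω r) • (u - G.vel ρ ω r))) Q := i1.add i2
  rw [ell, hσ, integral_congr_ae (ae_of_all _ h1), integral_add i12 (S.integrable_ell hr x u),
    integral_add i1 i2, integral_const_mul, integral_const_mul, h0, mul_zero, add_zero, mul_comm (‖v - u‖ ^ 2)]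
  rfl

theorem ell_add_eq (S : G.Standing Q ρ C B L) (hr : G.IsGoodTime Q ρ r) (x : Dom Λ)
    (v g : Euc d) : G.ell Q ρ r x (v + g) = G.ell Q ρ r x v + inner ℝ (G.flux Q r x v) g +
      2⁻¹ * G.a Q (G.time r) x * ‖g‖ ^ 2 := by
  rw [S.ell_eq hr, S.ell_eq hr, flux, inner_smul_left, add_sub_right_comm, norm_add_sq_real]
  simp only [RCLike.conj_to_real]
  ring

/-- The upper bound is `growth`; the lower one is `growth` from `x + h` back to `x`, combined with
`2 - E ≤ 1/E`. -/
theorem abs_η_sub_le (S : G.Standing Q ρ C B L) (x : Dom Λ) (h : Euc d) :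
    |G.η (x + toDom Λ h) - G.η x| ≤ (Real.exp (C * ‖h‖) - 1) * G.η x := by
  have h1 := S.growth x h
  have h2 := S.growth (x + toDom Λ h) (-h)
  rw [toDom_neg, add_neg_cancel_right, norm_neg] at h2
  have hη := S.η_pos x
  set E := Real.exp (C * ‖h‖) with hE
  have hE1 : 1 ≤ E := Real.one_le_exp (mul_nonneg S.C_nonneg (norm_nonneg _))
  rw [abs_le]
  constructor
  · have h3 : G.η x / E ≤ G.η (x + toDom Λ h) := by
      rw [div_le_iff₀ (by linarith)]
      linarith
    have h4 : (2 - E) * G.η x ≤ G.η x / E := by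
      rw [le_div_iff₀ (by linarith)]
      nlinarith [mul_nonneg (sq_nonneg (E - 1)) hη.le]
    linarith
  · linarith

/-- The relative bound on `η` passes through the integral over `Q`, so `ℓ` controls its own
increments and no higher moment of the velocities is needed. -/
theorem abs_ell_sub_le (S : G.Standing Q ρ C B L) (hr : G.IsGoodTime Q ρ r) (x : Dom Λ)
    (v h : Euc d) : |G.ell Q ρ r (x + toDom Λ h) v - G.ell Q ρ r x v| ≤
      (Real.exp (C * ‖h‖) - 1) * G.ell Q ρ r x v := by
  rw [ell, ell, ← mul_sub, ← integral_sub (S.integrable_ell hr _ v) (S.integrable_ell hr x v),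
    abs_mul, abs_of_pos (by norm_num : (0 : ℝ) < 2⁻¹), mul_left_comm, ← integral_const_mul]
  refine mul_le_mul_of_nonneg_left ?_ (by norm_num)
  rw [← Real.norm_eq_abs]
  refine norm_integral_le_of_norm_le ((S.integrable_ell hr x v).const_mul _) (ae_of_all _ fun ω => ?_)
  rw [← mul_sub, norm_mul, Real.norm_eq_abs, Real.norm_eq_abs, abs_of_nonneg (sq_nonneg _),
    mul_left_comm, add_sub_right_comm]
  exact mul_le_mul_of_nonneg_left (S.abs_η_sub_le _ h) (sq_nonneg _)

/-- From `s ≤ ½ + ½ s²`: first moments of relative velocities, hence the flux and its increments,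
are controlled by `ℓ`. -/
theorem integral_mul_norm_le (S : G.Standing Q ρ C B L) (hr : G.IsGoodTime Q ρ r) (x : Dom Λ)
    (v : Euc d) : Integrable (fun ω => G.η (x - G.pos ω r) * ‖v - G.vel ρ ω r‖) Q ∧
      ∫ ω, G.η (x - G.pos ω r) * ‖v - G.vel ρ ω r‖ ∂Q ≤ B / 2 + G.ell Q ρ r x v := by
  have hi : Integrable (fun ω => G.η (x - G.pos ω r) * ‖v - G.vel ρ ω r‖) Q := by
    refine (S.integrable_smul_sub hr x v).norm.congr (ae_of_all _ fun ω => ?_)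
    simp only [norm_smul, Real.norm_eq_abs, abs_of_pos (S.η_pos _)]
  refine ⟨hi, ?_⟩
  have h1 : ∫ ω, G.η (x - G.pos ω r) * ‖v - G.vel ρ ω r‖ ∂Q ≤
      ∫ ω, (2⁻¹ * G.η (x - G.pos ω r) + 2⁻¹ * (‖v - G.vel ρ ω r‖ ^ 2 * G.η (x - G.pos ω r))) ∂Q := by
    refine integral_mono hi (((S.integrable_η x r).const_mul _).add
      ((S.integrable_ell hr x v).const_mul _)) fun ω => ?_
    have := mul_nonneg (S.η_pos (x - G.pos ω r)).le (sq_nonneg (‖v - G.vel ρ ω r‖ - 1))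
    simp only
    linarith
  rw [integral_add ((S.integrable_η x r).const_mul _) ((S.integrable_ell hr x v).const_mul _),
    integral_const_mul, integral_const_mul] at h1
  have h2 : ∫ ω, G.η (x - G.pos ω r) ∂Q ≤ B := S.a_le x r
  rw [ell]
  linarith

theorem norm_flux_le (S : G.Standing Q ρ C B L) (hr : G.IsGoodTime Q ρ r) (x : Dom Λ)
    (v : Euc d) : ‖G.flux Q r x v‖ ≤ B / 2 + G.ell Q ρ r x v := by
  obtain ⟨h1, h2⟩ := S.integral_mul_norm_le hr x v
  rw [S.flux_eq hr]
  refine (norm_integral_le_of_norm_le h1 (ae_of_all _ fun ω => ?_)).trans h2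
  rw [norm_smul, Real.norm_eq_abs, abs_of_pos (S.η_pos _)]

theorem norm_flux_sub_le (S : G.Standing Q ρ C B L) (hr : G.IsGoodTime Q ρ r) (x : Dom Λ)
    (v h : Euc d) : ‖G.flux Q r (x + toDom Λ h) v - G.flux Q r x v‖ ≤
      (Real.exp (C * ‖h‖) - 1) * (B / 2 + G.ell Q ρ r x v) := by
  obtain ⟨h1, h2⟩ := S.integral_mul_norm_le hr x v
  have hE1 : 1 ≤ Real.exp (C * ‖h‖) := Real.one_le_exp (mul_nonneg S.C_nonneg (norm_nonneg _))
  rw [S.flux_eq hr, S.flux_eq hr, ← integral_sub (S.integrable_smul_sub hr _ v)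
    (S.integrable_smul_sub hr x v)]
  refine (norm_integral_le_of_norm_le (h1.const_mul (Real.exp (C * ‖h‖) - 1))
    (ae_of_all _ fun ω => ?_)).trans ?_
  · rw [← sub_smul, norm_smul, Real.norm_eq_abs, add_sub_right_comm, ← mul_assoc]
    exact mul_le_mul_of_nonneg_right (S.abs_η_sub_le _ h) (norm_nonneg _)
  · rw [integral_const_mul]
    exact mul_le_mul_of_nonneg_left h2 (sub_nonneg.2 hE1)

/-- The upper bound for the increments of the interaction density. -/
theorem ell_increment_le (S : G.Standing Q ρ C B L) (hr : G.IsGoodTime Q ρ r) (x : Dom Λ)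
    (v g h : Euc d) : G.ell Q ρ r (x + toDom Λ h) (v + g) ≤ G.ell Q ρ r (x + toDom Λ h) v +
      inner ℝ (G.flux Q r x v) g +
      (Real.exp (C * ‖h‖) - 1) * (B / 2 + G.ell Q ρ r x v) * ‖g‖ + 2⁻¹ * B * ‖g‖ ^ 2 := by
  rw [S.ell_add_eq hr]
  have h1 : inner ℝ (G.flux Q r (x + toDom Λ h) v) g - inner ℝ (G.flux Q r x v) g ≤
      (Real.exp (C * ‖h‖) - 1) * (B / 2 + G.ell Q ρ r x v) * ‖g‖ := by
    rw [← inner_sub_left]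
    exact (real_inner_le_norm _ _).trans
      (mul_le_mul_of_nonneg_right (S.norm_flux_sub_le hr x v h) (norm_nonneg _))
  have h2 : 2⁻¹ * G.a Q (G.time r) (x + toDom Λ h) * ‖g‖ ^ 2 ≤ 2⁻¹ * B * ‖g‖ ^ 2 := by
    gcongr
    exact S.a_le _ r
  linarith

/-- The difference quotients of the interaction density converge to the force. -/
theorem tendsto_ell (S : G.Standing Q ρ C B L) (hr : G.IsGoodTime Q ρ r) {x : Dom Λ}
    (v : Euc d) (ha : DiffAt (G.a Q (G.time r)) x) (hu : DiffAt (G.u Q (G.time r)) x)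
    (hσ : DiffAt (G.sigma Q (G.time r)) x) (e : Euc d) :
    Tendsto (fun n : ℕ => ((n : ℝ) + 1) * (G.lam * (G.ell Q ρ r (x + toDom Λ (((n : ℝ) + 1)⁻¹ • e)) v -
      G.ell Q ρ r x v))) atTop (𝓝 (inner ℝ (G.force Q (G.time r) x v) e)) := by
  set t := G.time r
  have h1 := DifferentiableAt.hasFDerivAt ha
  have h2 := DifferentiableAt.hasFDerivAt hu
  have h3 := DifferentiableAt.hasFDerivAt hσ
  have h4 := (((h1.mul ((h2.const_sub v).norm_sq)).add h3).const_mul (G.lam / 2)).lim e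
    (c := fun n : ℕ => (n : ℝ) + 1) (l := atTop) (by
      refine tendsto_norm_atTop_atTop.comp (tendsto_atTop_add_const_right _ _ tendsto_natCast_atTop_atTop))
  have hx0 : ∀ {F : Type} (f : Dom Λ → F), inChart f x 0 = f x := fun f => by
    rw [inChart, toDom_zero, add_zero]
  have hval : inner ℝ (G.force Q t x v) e = ((G.lam / 2) • ((inChart (G.a Q t) x 0 •
      ((2 : ℕ) • (innerSL ℝ (v - inChart (G.u Q t) x 0)).comp (-fderiv ℝ (inChart (G.u Q t) x) 0)) +
      ‖v - inChart (G.u Q t) x 0‖ ^ 2 • fderiv ℝ (inChart (G.a Q t) x) 0) +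
      fderiv ℝ (inChart (G.sigma Q t) x) 0)) e := by
    have hg : ∀ f : Dom Λ → ℝ, inner ℝ (grad f x) e = fderiv ℝ (inChart f x) 0 e := fun f => by
      rw [grad, gradient, InnerProductSpace.toDual_symm_apply]
    rw [force, inner_smul_left, inner_add_left, inner_add_left, inner_smul_left, inner_smul_left,
      hg, hg, ContinuousLinearMap.adjoint_inner_left, jacobian, ← neg_sub v, inner_neg_left]
    simp only [hx0, RCLike.conj_to_real, smul_eq_mul, nsmul_eq_mul, Nat.cast_ofNat,
      smul_apply, add_apply,
      ContinuousLinearMap.comp_apply, neg_apply, innerSL_apply_apply,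
      inner_neg_right]
    ring
  rw [hval]
  refine h4.congr fun n => ?_
  simp only [S.ell_eq hr, zero_add, smul_eq_mul]
  simp only [inChart, toDom_zero, add_zero, Pi.mul_apply, Pi.add_apply]
  ring

theorem tendsto_Ψ {x : Dom Λ} (h : DiffAt G.Ψ x) (e : Euc d) :
    Tendsto (fun n : ℕ => ((n : ℝ) + 1) * (G.Ψ (x + toDom Λ (((n : ℝ) + 1)⁻¹ • e)) - G.Ψ x)) atTop
      (𝓝 (inner ℝ (grad G.Ψ x) e)) := by
  have h1 := DifferentiableAt.hasFDerivAt h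
  have h4 := h1.lim e (c := fun n : ℕ => (n : ℝ) + 1) (l := atTop) (by
      refine tendsto_norm_atTop_atTop.comp (tendsto_atTop_add_const_right _ _ tendsto_natCast_atTop_atTop))
  have hval : inner ℝ (grad G.Ψ x) e = fderiv ℝ (inChart G.Ψ x) 0 e := by
    rw [grad, gradient, InnerProductSpace.toDual_symm_apply]
  rw [hval]
  refine h4.congr fun n => ?_
  simp [inChart]

end Standing

end Game

/-! ### Variation of the cost of an optimal curve. -/

/-- Bookkeeping for the two majorants in `increment_nonneg`, those of the interaction density and of
the squared speed. -/
theorem integral_linear_combination {T : ℝ} (hT : 0 ≤ T) {a b c : ℝ → ℝ}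
    (ha : IntegrableOn a (Ioc 0 T)) (hb : IntegrableOn b (Ioc 0 T)) (hc : IntegrableOn c (Ioc 0 T))
    (ε K c₀ c₁ : ℝ) :
    IntegrableOn (fun r => (a r + ε * b r) + (K * (c₀ + c r) + c₁)) (Ioc 0 T) ∧
    ∫ r in Ioc 0 T, ((a r + ε * b r) + (K * (c₀ + c r) + c₁)) =
      (∫ r in Ioc 0 T, a r) + ε * (∫ r in Ioc 0 T, b r) +
        (K * (c₀ * T + ∫ r in Ioc 0 T, c r) + c₁ * T) := by
  have hk : ∀ x : ℝ, IntegrableOn (fun _ : ℝ => x) (Ioc 0 T) := fun x => integrable_const x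
  have hkv : ∀ x : ℝ, ∫ _ in Ioc 0 T, x = x * T := fun x => by
    rw [setIntegral_const, Real.volume_real_Ioc_of_le hT, sub_zero, smul_eq_mul, mul_comm]
  have h1 : IntegrableOn (fun r => a r + ε * b r) (Ioc 0 T) := ha.add (hb.const_mul ε)
  have h3 : IntegrableOn (fun r => c₀ + c r) (Ioc 0 T) := (hk c₀).add hc
  have h2 : IntegrableOn (fun r => K * (c₀ + c r) + c₁) (Ioc 0 T) := (h3.const_mul K).add (hk c₁)
  refine ⟨h1.add h2, ?_⟩
  rw [integral_add h1 h2, integral_add ha (hb.const_mul ε), integral_add (h3.const_mul K) (hk c₁),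
    integral_const_mul, integral_const_mul, integral_add (hk c₀) hc, hkv, hkv]

namespace Game

variable {d : ℕ} {Λ : AddSubgroup (Euc d)} {G : Game Λ}

namespace Standing

variable {Q : Measure G.Path} {ρ C B : ℝ} {L : ℝ≥0}

theorem measurable_vel_curve (S : G.Standing Q ρ C B L) (γ : G.Path) :
    Measurable (G.vel ρ γ) := by
  have h := S.measurable_vel.comp (measurable_prodMk_right (y := γ))
  exact h

theorem stronglyMeasurable_ell (S : G.Standing Q ρ C B L) {y : ℝ → Dom Λ} (hy : Continuous y)
    {f : ℝ → Euc d} (hf : Measurable f) :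
    StronglyMeasurable fun r => G.ell Q ρ r (y r) (f r) := by
  have := S.equi.prob
  have hm : Measurable fun q : ℝ × G.Path => ‖f q.1 - G.vel ρ q.2 q.1‖ ^ 2 *
      G.η (y q.1 - G.pos q.2 q.1) :=
    (((hf.comp measurable_fst).sub S.measurable_vel).norm.pow_const 2).mul
      (measurable_comp_pos_sub G.η_cont hy)
  exact (hm.stronglyMeasurable.integral_prod_right' (ν := Q)).const_mul 2⁻¹

theorem aestronglyMeasurable_flux (S : G.Standing Q ρ C B L) {y : ℝ → Dom Λ} (hy : Continuous y)
    {f : ℝ → Euc d} (hf : Measurable f) :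
    AEStronglyMeasurable (fun r => G.flux Q r (y r) (f r)) (volume.restrict (Ioc 0 G.T)) := by
  have := S.equi.prob
  have hm : Measurable fun q : ℝ × G.Path =>
      G.η (y q.1 - G.pos q.2 q.1) • (f q.1 - G.vel ρ q.2 q.1) :=
    (measurable_comp_pos_sub G.η_cont hy).smul ((hf.comp measurable_fst).sub S.measurable_vel)
  refine (hm.stronglyMeasurable.integral_prod_right' (ν := Q)).aestronglyMeasurable.congr ?_
  filter_upwards [S.ae_isGoodTime] with r hr
  rw [S.flux_eq hr]

theorem meanInteraction_eq_ell (S : G.Standing Q ρ C B L) {γ : G.Path} {f : ℝ → Euc d}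
    (hf : IsWeakDeriv γ f) (hfm : Measurable f) :
    G.meanInteraction Q γ = ∫⁻ r in Ioc 0 G.T, ENNReal.ofReal (G.ell Q ρ r (G.pos γ r) (f r)) := by
  rw [S.meanInteraction_eq hf hfm]
  refine lintegral_congr_ae ?_
  filter_upwards [S.ae_isGoodTime] with r hr
  rw [ell, ENNReal.ofReal_mul (by norm_num), ofReal_integral_eq_lintegral_ofReal
    (S.integrable_ell hr _ _) (ae_of_all _ fun ω => mul_nonneg (sq_nonneg _) (S.η_pos _).le)]
  congr 1
  · rw [ENNReal.ofReal_inv_of_pos two_pos, ENNReal.ofReal_ofNat]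
  · refine lintegral_congr fun ω => ?_
    rw [ENNReal.ofReal_mul (sq_nonneg _), ENNReal.ofReal_pow (norm_nonneg _), ofReal_norm]

theorem integrableOn_ell_of_lt_top (S : G.Standing Q ρ C B L) {γ : G.Path} {f : ℝ → Euc d}
    (hf : IsWeakDeriv γ f) (hfm : Measurable f) (h : G.meanInteraction Q γ < ⊤) :
    IntegrableOn (fun r => G.ell Q ρ r (G.pos γ r) (f r)) (Ioc 0 G.T) := by
  refine ⟨(S.stronglyMeasurable_ell (continuous_pos γ) hfm).aestronglyMeasurable, ?_⟩
  rw [hasFiniteIntegral_iff_ofReal (ae_of_all _ fun r => S.ell_nonneg r _ _),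
    ← S.meanInteraction_eq_ell hf hfm]
  exact h

theorem toReal_meanInteraction (S : G.Standing Q ρ C B L) {γ : G.Path} {f : ℝ → Euc d}
    (hf : IsWeakDeriv γ f) (hfm : Measurable f) :
    (G.meanInteraction Q γ).toReal = ∫ r in Ioc 0 G.T, G.ell Q ρ r (G.pos γ r) (f r) := by
  rw [S.meanInteraction_eq_ell hf hfm, integral_eq_lintegral_of_nonneg_ae
    (ae_of_all _ fun r => S.ell_nonneg r _ _)
    (S.stronglyMeasurable_ell (continuous_pos γ) hfm).aestronglyMeasurable]

theorem cost_eq (S : G.Standing Q ρ C B L) {γ : G.Path} {f : ℝ → Euc d}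
    (hf : IsWeakDeriv γ f) (hfm : Measurable f)
    (hi : IntegrableOn (fun r => G.ell Q ρ r (G.pos γ r) (f r)) (Ioc 0 G.T)) :
    G.cost γ Q = ((G.δ * (2⁻¹ * ∫ r in Ioc 0 G.T, ‖f r‖ ^ 2) +
      G.lam * (∫ r in Ioc 0 G.T, G.ell Q ρ r (G.pos γ r) (f r)) + G.Ψ (γ G.t₁) : ℝ) : EReal) := by
  have hm : G.meanInteraction Q γ ≠ ⊤ := by
    rw [S.meanInteraction_eq_ell hf hfm]
    exact ((hasFiniteIntegral_iff_ofReal (ae_of_all _ fun r => S.ell_nonneg r _ _)).1 hi.2).ne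
  have hk : kinetic γ ≠ ⊤ := ((S.kinetic_eq_top_or γ).resolve_left fun h => by
    rw [hf.kinetic_eq S.sep G.T_pos] at h
    exact (ENNReal.mul_lt_top (by simp) hf.lintegral_lt_top).ne h).2.ne
  have h1 := ENNReal.mul_ne_top (ENNReal.ofReal_ne_top (r := G.δ)) hk
  have h2 := ENNReal.mul_ne_top (ENNReal.ofReal_ne_top (r := G.lam)) hm
  rw [cost, ← ENNReal.ofReal_toReal (ENNReal.add_ne_top.2 ⟨h1, h2⟩), EReal.coe_ennreal_ofReal,
    max_eq_left ENNReal.toReal_nonneg, ← EReal.coe_add, ENNReal.toReal_add h1 h2,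
    ENNReal.toReal_mul, ENNReal.toReal_mul, ENNReal.toReal_ofReal G.δ_pos.le,
    ENNReal.toReal_ofReal G.lam_pos.le, S.toReal_kinetic hf, S.toReal_meanInteraction hf hfm]

theorem integrableOn_flux (S : G.Standing Q ρ C B L) {y : ℝ → Dom Λ} (hy : Continuous y)
    {f : ℝ → Euc d} (hf : Measurable f)
    (hi : IntegrableOn (fun r => G.ell Q ρ r (y r) (f r)) (Ioc 0 G.T)) :
    IntegrableOn (fun r => G.flux Q r (y r) (f r)) (Ioc 0 G.T) := by
  refine ((integrable_const (B / 2)).add hi).mono' (S.aestronglyMeasurable_flux hy hf) ?_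
  filter_upwards [S.ae_isGoodTime] with r hr
  exact S.norm_flux_le hr _ _

theorem integrableOn_ell_shift (S : G.Standing Q ρ C B L) {y : ℝ → Dom Λ} (hy : Continuous y)
    {f : ℝ → Euc d} (hf : Measurable f)
    (hi : IntegrableOn (fun r => G.ell Q ρ r (y r) (f r)) (Ioc 0 G.T)) {φ : ℝ → Euc d}
    (hφ : Continuous φ) (h1 : ∀ r ∈ Icc 0 G.T, ‖φ r‖ ≤ 1) :
    IntegrableOn (fun r => G.ell Q ρ r (y r + toDom Λ (φ r)) (f r)) (Ioc 0 G.T) := by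
  have hm := S.stronglyMeasurable_ell (hy.add (continuous_toDom.comp hφ)) hf
  refine (hi.const_mul (Real.exp C)).mono' hm.aestronglyMeasurable ?_
  filter_upwards [S.ae_isGoodTime, ae_restrict_mem measurableSet_Ioc] with r hr hrT
  have h2 := S.abs_ell_sub_le hr (y r) (f r) (φ r)
  have h3 : Real.exp (C * ‖φ r‖) ≤ Real.exp C := Real.exp_le_exp.2
    (mul_le_of_le_one_right S.C_nonneg (h1 r (Ioc_subset_Icc_self hrT)))
  have h4 := mul_le_mul_of_nonneg_right h3 (S.ell_nonneg r (y r) (f r))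
  rw [Real.norm_eq_abs, abs_of_nonneg (S.ell_nonneg _ _ _)]
  linarith [(abs_le.1 h2).2]

/-- The increment of the cost of an optimal curve under the variation `ε φ`, where `φ' = g`. -/
theorem increment_nonneg (S : G.Standing Q ρ C B L) {γ : G.Path} (hγ : G.IsOptimal γ Q)
    {g : ℝ → Euc d} (hg : StronglyMeasurable g) {M : ℝ} (hM : ∀ r, ‖g r‖ ≤ M)
    (hφ1 : ∀ x ∈ Icc 0 G.T, ‖∫ r in (0 : ℝ)..x, g r‖ ≤ 1) {ε : ℝ} (hε : 0 < ε) (hε1 : ε ≤ 1) :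
    0 ≤ ε * (∫ r in Ioc 0 G.T,
        inner ℝ (G.δ • G.vel ρ γ r + G.lam • G.flux Q r (G.pos γ r) (G.vel ρ γ r)) (g r)) +
      (∫ r in Ioc 0 G.T, G.lam * (G.ell Q ρ r (G.pos γ r + toDom Λ (ε • ∫ s in (0 : ℝ)..r, g s))
        (G.vel ρ γ r) - G.ell Q ρ r (G.pos γ r) (G.vel ρ γ r))) +
      (G.Ψ (γ G.t₁ + toDom Λ (ε • ∫ s in (0 : ℝ)..G.T, g s)) - G.Ψ (γ G.t₁)) +
      ε * (G.δ / 2 * M ^ 2 * G.T * ε + G.lam * M * (B / 2 * G.T + ∫ r in Ioc 0 G.T,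
        G.ell Q ρ r (G.pos γ r) (G.vel ρ γ r)) * (Real.exp (C * ε) - 1) +
        G.lam / 2 * B * M ^ 2 * G.T * ε) := by
  obtain ⟨hH1, hk, hm, -⟩ := S.optimal_bound hγ
  set f := G.vel ρ γ with hf
  have hw : IsWeakDeriv γ f := S.isWeakDeriv hH1
  have hfm : Measurable f := S.measurable_vel_curve γ
  have hi := S.integrableOn_ell_of_lt_top hw hfm hm
  have hT := G.T_pos
  have hδ := G.δ_pos
  have hlam := G.lam_pos
  have hM0 : 0 ≤ M := (norm_nonneg _).trans (hM 0)
  set φ : ℝ → Euc d := fun x => ∫ r in (0 : ℝ)..x, g r with hφ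
  have hgi : ∀ a b, IntervalIntegrable g volume a b := fun a b =>
    (intervalIntegrable_const (c := M)).mono_fun hg.aestronglyMeasurable (ae_of_all _ fun r => by
      simp only [Real.norm_eq_abs]
      exact (hM r).trans (le_abs_self M))
  have hφc : Continuous φ := intervalIntegral.continuous_primitive hgi 0
  have hgL : MemLp g 2 (volume.restrict (Ioc 0 G.T)) :=
    MemLp.of_bound hg.aestronglyMeasurable M (ae_of_all _ hM)
  have hεφc : Continuous fun r => ε • φ r := hφc.const_smul ε
  have hεφ1 : ∀ r ∈ Icc 0 G.T, ‖ε • φ r‖ ≤ ε := fun r hr => by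
    rw [norm_smul, Real.norm_eq_abs, abs_of_pos hε]
    exact mul_le_of_le_one_right hε.le (hφ1 r hr)
  have hω := hw.add_toDom (g := fun r => ε • g r) (φ := fun r => ε • φ r) (hgL.const_smul ε) hεφc
    (fun s t => by
      rw [intervalIntegral.integral_smul, ← smul_add, hφ,
        intervalIntegral.integral_add_adjacent_intervals (hgi _ _) (hgi _ _)])
  set ω : G.Path := γ + ⟨fun t => toDom Λ (ε • φ t),
    continuous_toDom.comp (hεφc.comp continuous_subtype_val)⟩ with hωdef
  have hω0 : ω G.t₀ = γ G.t₀ := by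
    simp [hωdef, hφ, t₀]
  have hωpos : ∀ r ∈ Icc 0 G.T, G.pos ω r = G.pos γ r + toDom Λ (ε • φ r) := fun r hr => by
    have : (projIcc 0 G.T G.T_pos.le r : ℝ) = r := coe_time hr
    simp [pos, hωdef, this]
  have hω1 : ω G.t₁ = γ G.t₁ + toDom Λ (ε • φ G.T) := by
    simp [hωdef, t₁]
  have hsm : Measurable (f + fun r => ε • g r) := hfm.add (hg.measurable.const_smul ε)
  have hish := S.integrableOn_ell_shift (continuous_pos γ) hfm hi hεφc
    fun r hr => (hεφ1 r hr).trans hε1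
  have hflux := S.integrableOn_flux (continuous_pos γ) hfm hi
  have hfg : IntegrableOn (fun r => inner ℝ (G.flux Q r (G.pos γ r) (f r)) (g r)) (Ioc 0 G.T) := by
    refine (hflux.norm.mul_const M).mono' (hflux.aestronglyMeasurable.inner hg.aestronglyMeasurable)
      (ae_of_all _ fun r => ?_)
    exact (norm_inner_le_norm _ _).trans (mul_le_mul_of_nonneg_left (hM r) (norm_nonneg _))
  have hff : IntegrableOn (fun r => inner ℝ (f r) (g r)) (Ioc 0 G.T) := by
    refine ((hw.1.integrable one_le_two).norm.mul_const M).mono'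
      (hfm.aestronglyMeasurable.inner hg.aestronglyMeasurable) (ae_of_all _ fun r => ?_)
    exact (norm_inner_le_norm _ _).trans (mul_le_mul_of_nonneg_left (hM r) (norm_nonneg _))
  set E := Real.exp (C * ε) - 1 with hE
  obtain ⟨hlR, hlv⟩ := integral_linear_combination hT.le hish hfg hi ε (E * (ε * M)) (B / 2)
    (2⁻¹ * B * (ε * M) ^ 2)
  -- The shift in position is kept exact, at the old velocity, and only the change of velocity is
  -- linearised; no differentiability in `x` is needed, and the mixed error is of order `ε E`.
  have hle : ∀ᵐ r ∂volume.restrict (Ioc 0 G.T),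
      G.ell Q ρ r (G.pos ω r) ((f + fun r => ε • g r) r) ≤
      (G.ell Q ρ r (G.pos γ r + toDom Λ (ε • φ r)) (f r) +
      ε * inner ℝ (G.flux Q r (G.pos γ r) (f r)) (g r)) +
      (E * (ε * M) * (B / 2 + G.ell Q ρ r (G.pos γ r) (f r)) + 2⁻¹ * B * (ε * M) ^ 2) := by
    filter_upwards [S.ae_isGoodTime, ae_restrict_mem measurableSet_Ioc] with r hr hrT
    have hrT' := Ioc_subset_Icc_self hrT
    have h1 := S.ell_increment_le hr (G.pos γ r) (f r) (ε • g r) (ε • φ r)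
    rw [hωpos r hrT', Pi.add_apply]
    rw [inner_smul_right, norm_smul ε (g r), Real.norm_eq_abs, abs_of_pos hε] at h1
    have h2 : ε * ‖g r‖ ≤ ε * M := mul_le_mul_of_nonneg_left (hM r) hε.le
    have h3 : Real.exp (C * ‖ε • φ r‖) - 1 ≤ E := by
      rw [hE]
      gcongr
      · exact S.C_nonneg
      · exact hεφ1 r hrT'
    have h4 : 0 ≤ B / 2 + G.ell Q ρ r (G.pos γ r) (f r) :=
      add_nonneg (by linarith [S.B_pos]) (S.ell_nonneg _ _ _)
    have h5 : (Real.exp (C * ‖ε • φ r‖) - 1) * (B / 2 + G.ell Q ρ r (G.pos γ r) (f r)) * (ε * ‖g r‖) ≤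
        E * (B / 2 + G.ell Q ρ r (G.pos γ r) (f r)) * (ε * M) := by
      have h0 : 0 ≤ Real.exp (C * ‖ε • φ r‖) - 1 := sub_nonneg.2
        (Real.one_le_exp (mul_nonneg S.C_nonneg (norm_nonneg _)))
      gcongr
      exact mul_nonneg (h0.trans h3) h4
    have h6 : 2⁻¹ * B * (ε * ‖g r‖) ^ 2 ≤ 2⁻¹ * B * (ε * M) ^ 2 := by
      have := S.B_pos
      gcongr
    linarith
  have hωi : IntegrableOn (fun r => G.ell Q ρ r (G.pos ω r) ((f + fun r => ε • g r) r))
      (Ioc 0 G.T) := by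
    refine hlR.mono' (S.stronglyMeasurable_ell (continuous_pos ω) hsm).aestronglyMeasurable ?_
    filter_upwards [hle] with r hr
    rwa [Real.norm_eq_abs, abs_of_nonneg (S.ell_nonneg _ _ _)]
  have hcost : G.cost γ Q ≤ G.cost ω Q := by
    have h := hγ
    rw [IsOptimal] at h
    rw [h]
    exact iInf₂_le (f := fun (ω : G.Path) (_ : ω G.t₀ = γ G.t₀) => G.cost ω Q) ω hω0
  rw [S.cost_eq hw hfm hi, S.cost_eq hω hsm hωi, EReal.coe_le_coe_iff, hω1] at hcost
  have hint := integral_mono_ae hωi hlR hle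
  rw [hlv] at hint
  -- Expansion of `|f + εg|²`; the zero coefficient switches off the third function.
  obtain ⟨hkR, hkv⟩ := integral_linear_combination hT.le (integrable_norm_sq hw) hff hi (2 * ε) 0 0
    ((ε * M) ^ 2)
  have hkin : ∫ r in Ioc 0 G.T, ‖(f + fun r => ε • g r) r‖ ^ 2 ≤ _ :=
    integral_mono (integrable_norm_sq hω) hkR fun r => by
      have h2 : ε * ‖g r‖ ≤ ε * M := mul_le_mul_of_nonneg_left (hM r) hε.le
      have h3 : (ε * ‖g r‖) ^ 2 ≤ (ε * M) ^ 2 := by gcongr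
      simp only [Pi.add_apply]
      rw [norm_add_sq_real, inner_smul_right, norm_smul, Real.norm_eq_abs, abs_of_pos hε]
      linarith
  rw [hkv] at hkin
  have hp : ∫ r in Ioc 0 G.T, inner ℝ (G.δ • f r + G.lam • G.flux Q r (G.pos γ r) (f r)) (g r) =
      G.δ * (∫ r in Ioc 0 G.T, inner ℝ (f r) (g r)) +
        G.lam * ∫ r in Ioc 0 G.T, inner ℝ (G.flux Q r (G.pos γ r) (f r)) (g r) := by
    simp only [inner_add_left, real_inner_smul_left]
    rw [integral_add (hff.const_mul _) (hfg.const_mul _), integral_const_mul, integral_const_mul]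
  have hΘ : ∫ r in Ioc 0 G.T, G.lam * (G.ell Q ρ r (G.pos γ r + toDom Λ (ε • φ r)) (f r) -
      G.ell Q ρ r (G.pos γ r) (f r)) =
      G.lam * ((∫ r in Ioc 0 G.T, G.ell Q ρ r (G.pos γ r + toDom Λ (ε • φ r)) (f r)) -
        ∫ r in Ioc 0 G.T, G.ell Q ρ r (G.pos γ r) (f r)) := by
    rw [integral_const_mul, integral_sub hish hi]
  rw [hp, hΘ]
  have h1 := mul_le_mul_of_nonneg_left hint hlam.le
  have h2 := mul_le_mul_of_nonneg_left hkin (show 0 ≤ G.δ * 2⁻¹ by positivity)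
  linarith

end Standing

end Game

/-! ### Existence and uniqueness of the momentum. -/

theorem Real.exp_sub_one_le_mul_exp (x : ℝ) : Real.exp x - 1 ≤ x * Real.exp x := by
  have h := mul_le_mul_of_nonneg_right (Real.add_one_le_exp (-x)) (Real.exp_pos x).le
  rw [← Real.exp_add, neg_add_cancel, Real.exp_zero] at h
  linarith

namespace Game

variable {d : ℕ} {Λ : AddSubgroup (Euc d)} {G : Game Λ}

namespace Standing

variable {Q : Measure G.Path} {ρ C B : ℝ} {L : ℝ≥0}

/-- Optimal curves satisfy the first variation inequality. -/
theorem firstVariation (S : G.Standing Q ρ C B L) {γ : G.Path} (hγ : G.IsOptimal γ Q) :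
    FirstVariation G.T
      ((Ioc 0 G.T).indicator fun r =>
        G.δ • G.vel ρ γ r + G.lam • G.flux Q r (G.pos γ r) (G.vel ρ γ r))
      ((Ioc 0 G.T).indicator fun r =>
        G.lam * (C * Real.exp C) * G.ell Q ρ r (G.pos γ r) (G.vel ρ γ r))
      (fun n r h => ((n : ℝ) + 1) * (G.lam * (G.ell Q ρ r
        (G.pos γ r + toDom Λ (((n : ℝ) + 1)⁻¹ • h)) (G.vel ρ γ r) -
          G.ell Q ρ r (G.pos γ r) (G.vel ρ γ r))))
      (fun n h => ((n : ℝ) + 1) * (G.Ψ (γ G.t₁ + toDom Λ (((n : ℝ) + 1)⁻¹ • h)) - G.Ψ (γ G.t₁)))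
      L := by
  obtain ⟨hH1, hk, hm, -⟩ := S.optimal_bound hγ
  have hw := S.isWeakDeriv hH1
  have hfm := S.measurable_vel_curve γ
  have hi := S.integrableOn_ell_of_lt_top hw hfm hm
  have hlam := G.lam_pos
  have hN : ∀ n : ℕ, (0 : ℝ) < (n : ℝ) + 1 := fun n => by positivity
  refine ⟨G.T_pos, ?_, ?_, fun r => ?_, fun n φ hφ => ?_, ?_, fun n h => ?_, ?_⟩
  · exact (integrable_indicator_iff measurableSet_Ioc).2
      (((hw.1.integrable one_le_two).smul G.δ).add
        ((S.integrableOn_flux (continuous_pos γ) hfm hi).smul G.lam))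
  · exact (integrable_indicator_iff measurableSet_Ioc).2 (hi.const_mul _)
  · exact indicator_nonneg (fun r _ => mul_nonneg (mul_nonneg hlam.le (mul_nonneg S.C_nonneg
      (Real.exp_pos _).le)) (S.ell_nonneg _ _ _)) r
  · have hφ' : Continuous fun r => ((n : ℝ) + 1)⁻¹ • φ r := hφ.const_smul ((n : ℝ) + 1)⁻¹
    have hc : Continuous fun r => G.pos γ r + toDom Λ (((n : ℝ) + 1)⁻¹ • φ r) :=
      (continuous_pos γ).add (continuous_toDom.comp hφ')
    have h1 := (S.stronglyMeasurable_ell hc hfm).sub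
      (S.stronglyMeasurable_ell (continuous_pos γ) hfm)
    exact ((h1.const_mul G.lam).const_mul ((n : ℝ) + 1)).aestronglyMeasurable
  · filter_upwards [S.ae_isGoodTime, ae_restrict_mem measurableSet_Ioc] with r hr hrT n h hh
    set l := G.ell Q ρ r (G.pos γ r) (G.vel ρ γ r)
    have hl : 0 ≤ l := S.ell_nonneg _ _ _
    have h1 := S.abs_ell_sub_le hr (G.pos γ r) (G.vel ρ γ r) (((n : ℝ) + 1)⁻¹ • h)
    have hx : ‖((n : ℝ) + 1)⁻¹ • h‖ = ((n : ℝ) + 1)⁻¹ * ‖h‖ := by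
      rw [norm_smul, Real.norm_eq_abs, abs_of_pos (inv_pos.2 (hN n))]
    have hx1 : C * (((n : ℝ) + 1)⁻¹ * ‖h‖) ≤ C := by
      refine mul_le_of_le_one_right S.C_nonneg (mul_le_one₀ ?_ (norm_nonneg _) hh)
      exact inv_le_one_of_one_le₀ (by linarith [(Nat.cast_nonneg n : (0 : ℝ) ≤ n)])
    have h2 : Real.exp (C * (((n : ℝ) + 1)⁻¹ * ‖h‖)) - 1 ≤
        C * (((n : ℝ) + 1)⁻¹ * ‖h‖) * Real.exp C := by
      refine (Real.exp_sub_one_le_mul_exp _).trans ?_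
      refine mul_le_mul_of_nonneg_left (Real.exp_le_exp.2 hx1) ?_
      exact mul_nonneg S.C_nonneg (mul_nonneg (inv_pos.2 (hN n)).le (norm_nonneg _))
    rw [hx] at h1
    rw [indicator_of_mem hrT, abs_mul, abs_mul, abs_of_pos (hN n), abs_of_pos hlam]
    calc ((n : ℝ) + 1) * (G.lam * _) ≤ ((n : ℝ) + 1) *
          (G.lam * (C * (((n : ℝ) + 1)⁻¹ * ‖h‖) * Real.exp C * l)) := by
          refine mul_le_mul_of_nonneg_left (mul_le_mul_of_nonneg_left ?_ hlam.le) (hN n).le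
          exact h1.trans (mul_le_mul_of_nonneg_right h2 hl)
      _ = G.lam * (C * Real.exp C) * l * ‖h‖ := by
          have := (hN n).ne'
          field_simp
  · have h1 := S.lip.dist_le_mul (γ G.t₁ + toDom Λ (((n : ℝ) + 1)⁻¹ • h)) (γ G.t₁)
    rw [Real.dist_eq, dist_eq_norm, add_sub_cancel_left] at h1
    have h2 := h1.trans (mul_le_mul_of_nonneg_left (norm_toDom_le _) L.2)
    rw [norm_smul, Real.norm_eq_abs, abs_of_pos (inv_pos.2 (hN n))] at h2
    rw [abs_mul, abs_of_pos (hN n)]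
    calc _ ≤ ((n : ℝ) + 1) * (L * (((n : ℝ) + 1)⁻¹ * ‖h‖)) :=
          mul_le_mul_of_nonneg_left h2 (hN n).le
      _ = L * ‖h‖ := by
          have := (hN n).ne'
          field_simp
  · rintro g hg ⟨M, hM⟩ hφ1 ε hε
    set I := ∫ r in Ioc 0 G.T, G.ell Q ρ r (G.pos γ r) (G.vel ρ γ r) with hI
    -- The remainder of `increment_nonneg` at `ε = 1/(n+1)`, after division by `ε`.
    have hlim : Tendsto (fun n : ℕ => G.δ / 2 * M ^ 2 * G.T * ((n : ℝ) + 1)⁻¹ +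
        G.lam * M * (B / 2 * G.T + I) * (Real.exp (C * ((n : ℝ) + 1)⁻¹) - 1) +
        G.lam / 2 * B * M ^ 2 * G.T * ((n : ℝ) + 1)⁻¹) atTop (𝓝 0) := by
      have h0 : Tendsto (fun n : ℕ => ((n : ℝ) + 1)⁻¹) atTop (𝓝 0) := by
        simpa using tendsto_one_div_add_atTop_nhds_zero_nat (𝕜 := ℝ)
      have hc : Continuous fun x : ℝ => G.δ / 2 * M ^ 2 * G.T * x +
        G.lam * M * (B / 2 * G.T + I) * (Real.exp (C * x) - 1) +
        G.lam / 2 * B * M ^ 2 * G.T * x := by fun_prop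
      have h1 := (hc.tendsto 0).comp h0
      simp only [mul_zero, Real.exp_zero, sub_self, add_zero] at h1
      exact h1
    filter_upwards [hlim.eventually (ge_mem_nhds hε)] with n hn
    have h1 := S.increment_nonneg hγ hg hM hφ1 (inv_pos.2 (hN n))
      (inv_le_one_of_one_le₀ (by linarith [(Nat.cast_nonneg n : (0 : ℝ) ≤ n)]))
    have h2 := mul_nonneg (hN n).le h1
    rw [mul_add, mul_add, mul_add, mul_inv_cancel_left₀ (hN n).ne', mul_inv_cancel_left₀ (hN n).ne',
      ← integral_const_mul] at h2
    rw [intervalIntegral.integral_of_le G.T_pos.le, intervalIntegral.integral_of_le G.T_pos.le,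
      setIntegral_congr_fun measurableSet_Ioc (g := fun r => inner ℝ (G.δ • G.vel ρ γ r +
        G.lam • G.flux Q r (G.pos γ r) (G.vel ρ γ r)) (g r)) fun r hr => by
          simp only [indicator_of_mem hr]]
    linarith

/-- A bound on the momenta of all the optimal curves. -/
noncomputable def momentumConst (G : Game Λ) (Q : Measure G.Path) (C B : ℝ) (L : ℝ≥0) : ℝ :=
  L + C * Real.exp C *
    (G.lam * (B * (∫⁻ γ, kinetic γ ∂Q).toReal) + G.T * (L ^ 2 / G.δ))

/-- The momentum is the representative supplied by the first variation. Its bound is uniform because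
`∫ k` equals `C exp(C)` times the weighted interaction cost of `γ`, which `optimal_bound` estimates
independently of `γ`. -/
theorem exists_isMomentum (S : G.Standing Q ρ C B L) {γ : G.Path} (hγ : G.IsOptimal γ Q) :
    ∃ z, G.IsMomentum Q γ z ∧ ∀ t ∈ Icc 0 G.T, ‖z t‖ ≤ momentumConst G Q C B L := by
  have H := S.firstVariation hγ
  obtain ⟨z, hz, hzac, hzp⟩ := H.exists_continuous_ae_eq
  have hT := G.T_pos.le
  refine ⟨z, ⟨hzac, ?_, ?_, fun hd => ?_⟩, fun t ht => ?_⟩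
  · rw [ae_timeMeasure_iff hT]
    filter_upwards [hzp, S.ae_isGoodTime, ae_restrict_mem measurableSet_Ioc] with r h1 h2 h3
    have h4 : (projIcc 0 G.T hT r : ℝ) = r := coe_time (Ioc_subset_Icc_self h3)
    have h5 : velocity γ (projIcc 0 G.T hT r) = G.vel ρ γ r := S.velocity_time h2.1 γ
    rw [h4, h1, indicator_of_mem h3, h5, flux, smul_smul]
    rfl
  · rw [ae_timeMeasure_iff hT]
    filter_upwards [H.ae_hasDerivAt hz hzp, S.ae_isGoodTime, ae_restrict_mem measurableSet_Ioc]
      with r h1 h2 h3 ha hu hσ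
    have h4 : (projIcc 0 G.T hT r : ℝ) = r := coe_time (Ioc_subset_Icc_self h3)
    have h5 : velocity γ (projIcc 0 G.T hT r) = G.vel ρ γ r := S.velocity_time h2.1 γ
    rw [h4, h5]
    exact h1 _ fun e => S.tendsto_ell h2 (G.vel ρ γ r) ha hu hσ e
  · exact H.eq_neg_of_tendsto hz hzp fun e => tendsto_Ψ hd e
  · refine (H.norm_le L.2 hz hzp ht).trans ?_
    obtain ⟨hH1, -, -, hb⟩ := S.optimal_bound hγ
    have h1 : ∫ r in Ioc 0 G.T, (Ioc 0 G.T).indicator (fun r =>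
        G.lam * (C * Real.exp C) * G.ell Q ρ r (G.pos γ r) (G.vel ρ γ r)) r =
        C * Real.exp C * (G.lam * (G.meanInteraction Q γ).toReal) := by
      rw [S.toReal_meanInteraction (S.isWeakDeriv hH1) (S.measurable_vel_curve γ),
        setIntegral_indicator measurableSet_Ioc, inter_self, integral_const_mul]
      ring
    rw [h1, momentumConst]
    exact add_le_add le_rfl
      (mul_le_mul_of_nonneg_left hb (mul_nonneg S.C_nonneg (Real.exp_pos _).le))

end Standing

/-- Two continuous functions that agree almost everywhere. Hence bounding one momentum of each
optimal curve bounds the supremum over all of them. -/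
theorem IsMomentum.eqOn {Q : Measure G.Path} {γ : G.Path} {z z' : ℝ → Euc d}
    (hz : G.IsMomentum Q γ z) (hz' : G.IsMomentum Q γ z') : EqOn z z' (Icc 0 G.T) := by
  have hT := G.T_pos
  have h1 := hz.absCont.continuousOn
  have h2 := hz'.absCont.continuousOn
  rw [uIcc_of_le hT.le] at h1 h2
  refine Measure.eqOn_Icc_of_ae_eq volume hT.ne ?_ h1 h2
  rw [← Measure.restrict_congr_set (Ioc_ae_eq_Icc (μ := volume))]
  filter_upwards [(ae_timeMeasure_iff hT.le _).1 hz.eq_momentum,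
    (ae_timeMeasure_iff hT.le _).1 hz'.eq_momentum, ae_restrict_mem measurableSet_Ioc] with r h3 h4 h5
  rw [projIcc_of_mem hT.le (Ioc_subset_Icc_self h5)] at h3 h4
  exact h3.trans h4.symm

/-! ### From the momentum bound to the speed bound. -/

namespace Standing

variable {Q : Measure G.Path} {ρ C B : ℝ} {L : ℝ≥0} {r : ℝ}

theorem momentumBound_lt_top (S : G.Standing Q ρ C B L) : G.momentumBound Q < ⊤ := by
  refine lt_of_le_of_lt (b := ENNReal.ofReal (momentumConst G Q C B L)) ?_ ENNReal.ofReal_lt_top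
  refine iSup₂_le fun γ hγ => iSup₂_le fun z hz => iSup_le fun t => ?_
  obtain ⟨z', hz', hb⟩ := S.exists_isMomentum hγ
  rw [hz.eqOn hz' t.2, ← ofReal_norm]
  exact ENNReal.ofReal_le_ofReal (hb t t.2)

theorem ae_norm_momentum_le (S : G.Standing Q ρ C B L) {γ : G.Path} (hγ : G.IsOptimal γ Q) :
    ∀ᵐ r ∂volume.restrict (Ioc 0 G.T),
      ‖G.δ • G.vel ρ γ r + G.lam • G.flux Q r (G.pos γ r) (G.vel ρ γ r)‖ ≤
        (G.momentumBound Q).toReal := by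
  obtain ⟨z, hz, -⟩ := S.exists_isMomentum hγ
  filter_upwards [(ae_timeMeasure_iff G.T_pos.le _).1 hz.eq_momentum, S.ae_isGoodTime] with r h1 h2
  have h3 : velocity γ (projIcc 0 G.T G.T_pos.le r) = G.vel ρ γ r := S.velocity_time h2.1 γ
  have h4 : G.δ • G.vel ρ γ r + G.lam • G.flux Q r (G.pos γ r) (G.vel ρ γ r) = z (G.time r) := by
    rw [flux, smul_smul, ← h3]
    exact h1.symm
  rw [h4, ← toReal_enorm]
  refine ENNReal.toReal_mono S.momentumBound_lt_top.ne ?_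
  exact le_iSup₂_of_le γ hγ (le_iSup₂_of_le z hz (le_iSup_of_le (G.time r) le_rfl))

/-- The bound holds for each player at almost every time; Fubini exchanges the two quantifiers. For
joint measurability the flux is written as an integral over `Q`, with which it agrees at good times.
-/
theorem ae_ae_norm_momentum_le (S : G.Standing Q ρ C B L) :
    ∀ᵐ r ∂volume.restrict (Ioc 0 G.T), ∀ᵐ ω ∂Q,
      ‖G.δ • G.vel ρ ω r + G.lam • G.flux Q r (G.pos ω r) (G.vel ρ ω r)‖ ≤
        (G.momentumBound Q).toReal := by
  have := S.equi.prob
  have hη : Measurable fun q : (ℝ × G.Path) × G.Path =>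
      G.η (G.pos q.1.2 q.1.1 - G.pos q.2 q.1.1) := by
    have h1 : Continuous fun q : (ℝ × G.Path) × G.Path => G.pos q.1.2 q.1.1 :=
      continuous_curve_eval.comp ((continuous_snd.comp continuous_fst).prodMk
        ((continuous_projIcc (h := G.T_pos.le)).comp (continuous_fst.comp continuous_fst)))
    have h2 : Continuous fun q : (ℝ × G.Path) × G.Path => G.pos q.2 q.1.1 :=
      continuous_curve_eval.comp (continuous_snd.prodMk
        ((continuous_projIcc (h := G.T_pos.le)).comp (continuous_fst.comp continuous_fst)))
    exact (G.η_cont.comp (h1.sub h2)).measurable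
  have hv1 : Measurable fun q : (ℝ × G.Path) × G.Path => G.vel ρ q.1.2 q.1.1 := by
    have h := S.measurable_vel.comp (show Measurable fun q : (ℝ × G.Path) × G.Path => q.1 from measurable_fst)
    exact h
  have hv2 : Measurable fun q : (ℝ × G.Path) × G.Path => G.vel ρ q.2 q.1.1 := by
    have h := S.measurable_vel.comp
      (show Measurable fun q : (ℝ × G.Path) × G.Path => (q.1.1, q.2) from
        (measurable_fst.comp measurable_fst).prodMk measurable_snd)
    exact h
  have hJ : StronglyMeasurable fun q : ℝ × G.Path => ∫ ω, G.η (G.pos q.2 q.1 - G.pos ω q.1) •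
      (G.vel ρ q.2 q.1 - G.vel ρ ω q.1) ∂Q :=
    (hη.smul (hv1.sub hv2)).stronglyMeasurable.integral_prod_right' (ν := Q)
  have hset : MeasurableSet {q : ℝ × G.Path | ‖G.δ • G.vel ρ q.2 q.1 + G.lam •
      ∫ ω, G.η (G.pos q.2 q.1 - G.pos ω q.1) • (G.vel ρ q.2 q.1 - G.vel ρ ω q.1) ∂Q‖ ≤
        (G.momentumBound Q).toReal} :=
    measurableSet_le ((S.measurable_vel.const_smul G.δ).add
      (hJ.measurable.const_smul G.lam)).norm measurable_const
  have h1 : ∀ᵐ r ∂volume.restrict (Ioc 0 G.T), ∀ᵐ ω ∂Q, ‖G.δ • G.vel ρ ω r + G.lam •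
      ∫ ω', G.η (G.pos ω r - G.pos ω' r) • (G.vel ρ ω r - G.vel ρ ω' r) ∂Q‖ ≤
        (G.momentumBound Q).toReal := by
    rw [Measure.ae_ae_comm hset]
    filter_upwards [Measure.support_mem_ae] with ω hω
    filter_upwards [S.ae_norm_momentum_le (S.equi.optimal ω hω), S.ae_isGoodTime] with r hr hg
    rwa [S.flux_eq hg] at hr
  filter_upwards [h1, S.ae_isGoodTime] with r hr hg
  filter_upwards [hr] with ω hω
  rwa [S.flux_eq hg]

theorem mul_norm_le (S : G.Standing Q ρ C B L) (hr : G.IsGoodTime Q ρ r) {x : Dom Λ}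
    {v : Euc d} {Z : ℝ} (hZ : ‖G.δ • v + G.lam • G.flux Q r x v‖ ≤ Z) :
    (G.δ + G.lam * G.a Q (G.time r) x) * ‖v‖ ≤
      Z + G.lam * ∫ ω, G.η (x - G.pos ω r) * ‖G.vel ρ ω r‖ ∂Q := by
  have hδ := G.δ_pos
  have hlam := G.lam_pos
  have ha := S.a_pos x r
  have h1 : (G.δ + G.lam * G.a Q (G.time r) x) • v = (G.δ • v + G.lam • G.flux Q r x v) +
      G.lam • ∫ ω, G.η (x - G.pos ω r) • G.vel ρ ω r ∂Q := by
    rw [← S.a_smul_u hr, flux]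
    module
  have h2 : ‖∫ ω, G.η (x - G.pos ω r) • G.vel ρ ω r ∂Q‖ ≤
      ∫ ω, G.η (x - G.pos ω r) * ‖G.vel ρ ω r‖ ∂Q := by
    refine (norm_integral_le_integral_norm _).trans_eq (integral_congr_ae (ae_of_all _ fun ω => ?_))
    simp only [norm_smul, Real.norm_eq_abs, abs_of_pos (S.η_pos _)]
  calc (G.δ + G.lam * G.a Q (G.time r) x) * ‖v‖ = ‖(G.δ + G.lam * G.a Q (G.time r) x) • v‖ := by
        rw [norm_smul, Real.norm_eq_abs, abs_of_pos (by positivity)]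
    _ ≤ Z + G.lam * ∫ ω, G.η (x - G.pos ω r) * ‖G.vel ρ ω r‖ ∂Q := by
        rw [h1]
        refine (norm_add_le _ _).trans (add_le_add hZ ?_)
        rw [norm_smul, Real.norm_eq_abs, abs_of_pos hlam]
        exact mul_le_mul_of_nonneg_left h2 hlam.le

theorem integrable_mul_norm_vel (S : G.Standing Q ρ C B L) (hr : G.IsGoodTime Q ρ r) (x : Dom Λ) :
    Integrable (fun ω => G.η (x - G.pos ω r) * ‖G.vel ρ ω r‖) Q := by
  refine (S.integrable_smul_vel hr x).norm.congr (ae_of_all _ fun ω => ?_)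
  simp only [norm_smul, Real.norm_eq_abs, abs_of_pos (S.η_pos _)]

/-- A bound on the velocities of the players improves itself. -/
theorem norm_le_of_ae_norm_le (S : G.Standing Q ρ C B L) (hr : G.IsGoodTime Q ρ r) {x : Dom Λ}
    {v : Euc d} {Z c : ℝ} (hc : 0 ≤ c) (hZ : ‖G.δ • v + G.lam • G.flux Q r x v‖ ≤ Z)
    (h : ∀ᵐ ω ∂Q, ‖G.vel ρ ω r‖ ≤ Z / G.δ + c) :
    ‖v‖ ≤ Z / G.δ + G.lam * B / (G.δ + G.lam * B) * c := by
  have hδ := G.δ_pos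
  have hlam := G.lam_pos
  have ha := S.a_pos x r
  have haB := S.a_le x r
  have hB := S.B_pos
  set a := G.a Q (G.time r) x with hadef
  have h1 : ∫ ω, G.η (x - G.pos ω r) * ‖G.vel ρ ω r‖ ∂Q ≤ a * (Z / G.δ + c) := by
    have : a * (Z / G.δ + c) = ∫ ω, G.η (x - G.pos ω r) * (Z / G.δ + c) ∂Q := by
      rw [integral_mul_const]
      rfl
    rw [this]
    refine integral_mono_ae (S.integrable_mul_norm_vel hr x)
      ((S.integrable_η x r).mul_const _) ?_
    filter_upwards [h] with ω hω
    exact mul_le_mul_of_nonneg_left hω (S.η_pos _).le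
  have h2 := (S.mul_norm_le hr hZ).trans (add_le_add le_rfl (mul_le_mul_of_nonneg_left h1 hlam.le))
  -- `Z/δ` is a fixed point of the estimate, and the excess `c` shrinks by `λa/(δ + λa)`, which
  -- increases with `a ≤ B`; no positive lower bound on `a` is needed.
  have h3 : Z + G.lam * (a * (Z / G.δ + c)) =
      (G.δ + G.lam * a) * (Z / G.δ + G.lam * a / (G.δ + G.lam * a) * c) := by
    have : G.δ + G.lam * a ≠ 0 := by positivity
    field_simp
    ring
  rw [h3] at h2
  have h4 := le_of_mul_le_mul_left h2 (by positivity)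
  have h5 : G.lam * a / (G.δ + G.lam * a) ≤ G.lam * B / (G.δ + G.lam * B) := by
    rw [div_le_div_iff₀ (by positivity) (by positivity)]
    have : G.lam * a ≤ G.lam * B := mul_le_mul_of_nonneg_left haB hlam.le
    nlinarith
  exact h4.trans (add_le_add le_rfl (mul_le_mul_of_nonneg_right h5 hc))

/-- Iterates `norm_le_of_ae_norm_le`. The starting bound uses the mean speed at the time `r`; it
need not be uniform in `r`, since the geometric factor `q ^ n` removes it in the limit. -/
theorem ae_norm_vel_le (S : G.Standing Q ρ C B L) (hr : G.IsGoodTime Q ρ r) {Z : ℝ}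
    (h : ∀ᵐ ω ∂Q, ‖G.δ • G.vel ρ ω r + G.lam • G.flux Q r (G.pos ω r) (G.vel ρ ω r)‖ ≤ Z) :
    ∀ᵐ ω ∂Q, ‖G.vel ρ ω r‖ ≤ Z / G.δ := by
  have := S.equi.prob
  have hδ := G.δ_pos
  have hlam := G.lam_pos
  have hB := S.B_pos
  set q := G.lam * B / (G.δ + G.lam * B) with hq
  have hq0 : 0 ≤ q := by positivity
  have hq1 : q < 1 := by
    rw [hq, div_lt_one (by positivity)]
    linarith
  set m := ∫ ω, ‖G.vel ρ ω r‖ ∂Q with hm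
  have hm0 : 0 ≤ m := integral_nonneg fun _ => norm_nonneg _
  set c := G.lam * (B * m) / G.δ with hc
  have hc0 : 0 ≤ c := by positivity
  have h0 : ∀ᵐ ω ∂Q, ‖G.vel ρ ω r‖ ≤ Z / G.δ + c := by
    filter_upwards [h] with ω hω
    have h1 := S.mul_norm_le hr hω
    have h2 : ∫ ω', G.η (G.pos ω r - G.pos ω' r) * ‖G.vel ρ ω' r‖ ∂Q ≤ B * m := by
      rw [hm, ← integral_const_mul]
      exact integral_mono (S.integrable_mul_norm_vel hr _)
        (((S.memLp_vel hr).integrable one_le_two).norm.const_mul B) fun ω' =>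
        mul_le_mul_of_nonneg_right (S.bound _) (norm_nonneg _)
    have h3 : G.δ * ‖G.vel ρ ω r‖ ≤ (G.δ + G.lam * G.a Q (G.time r) (G.pos ω r)) * ‖G.vel ρ ω r‖ := by
      have := S.a_pos (G.pos ω r) r
      gcongr
      exact le_add_of_nonneg_right (by positivity)
    rw [hc, ← add_div, le_div_iff₀ hδ]
    linarith [mul_le_mul_of_nonneg_left h2 hlam.le]
  have hn : ∀ n : ℕ, ∀ᵐ ω ∂Q, ‖G.vel ρ ω r‖ ≤ Z / G.δ + q ^ n * c := by
    intro n
    induction n with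
    | zero => simpa using h0
    | succ n ih =>
      filter_upwards [h] with ω hω
      have := S.norm_le_of_ae_norm_le hr (by positivity) hω ih
      rwa [pow_succ', mul_assoc]
  filter_upwards [ae_all_iff.2 hn] with ω hω
  have hlim : Tendsto (fun n : ℕ => Z / G.δ + q ^ n * c) atTop (𝓝 (Z / G.δ + 0 * c)) :=
    tendsto_const_nhds.add ((tendsto_pow_atTop_nhds_zero_of_lt_one hq0 hq1).mul_const c)
  rw [zero_mul, add_zero] at hlim
  exact ge_of_tendsto' hlim hω

/-- The velocities of optimal curves are bounded by the momenta. -/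
theorem ae_norm_vel_le_momentumBound (S : G.Standing Q ρ C B L) {γ : G.Path}
    (hγ : G.IsOptimal γ Q) : ∀ᵐ r ∂volume.restrict (Ioc 0 G.T),
      ‖G.vel ρ γ r‖ ≤ (G.momentumBound Q).toReal / G.δ := by
  filter_upwards [S.ae_norm_momentum_le hγ, S.ae_ae_norm_momentum_le, S.ae_isGoodTime] with r h1 h2 h3
  -- One more round with zero excess passes the bound from almost every player to the given optimal
  -- curve, which `Q` may not charge.
  have h4 := S.norm_le_of_ae_norm_le h3 (c := 0) le_rfl h1 (by
    simpa using S.ae_norm_vel_le h3 h2)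
  simpa using h4

theorem lipschitzWith (S : G.Standing Q ρ C B L) {γ : G.Path} (hγ : G.IsOptimal γ Q) :
    LipschitzWith ((G.momentumBound Q).toNNReal / G.δ.toNNReal) γ := by
  have hw := S.isWeakDeriv (S.optimal_bound hγ).1
  refine LipschitzWith.of_dist_le_mul fun t s => ?_
  rw [dist_eq_norm, hw.2 s t, add_sub_cancel_left, NNReal.coe_div, Real.coe_toNNReal _ G.δ_pos.le,
    Subtype.dist_eq, Real.dist_eq]
  refine (norm_toDom_le _).trans (intervalIntegral.norm_integral_le_of_norm_le_const_ae ?_)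
  filter_upwards [(ae_restrict_iff' measurableSet_Ioc).1 (S.ae_norm_vel_le_momentumBound hγ)]
    with r hr hrm
  exact hr (Ioc_subset_Ioc (le_min s.2.1 t.2.1) (max_le s.2.2 t.2.2) hrm)

end Standing

end Game

theorem mainTheorem4 {d : ℕ} {Λ : AddSubgroup (Euc d)} (hΩ : IsSpaceOrTorusLattice Λ)
    (G : Game Λ)
    (hη_pos : ∀ x, 0 < G.η x)
    (hη_lip : ∃ C : ℝ≥0, LipschitzWith C G.η)
    (hη_grad : ∃ C : ℝ, ∀ x, DiffAt G.η x → ‖grad G.η x‖ ≤ C * G.η x)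
    (hΨ : ∃ C : ℝ≥0, LipschitzWith C G.Ψ)
    (hm₀ : ∫⁻ x, ENNReal.ofReal (-G.Ψ x) ∂G.m₀ < ⊤)
    (Q : Measure G.Path) (hQ : G.IsEquilibrium Q) :
    (∀ γ : G.Path, G.IsOptimal γ Q → ∃ z, G.IsMomentum Q γ z) ∧
    G.momentumBound Q < ⊤ ∧
    ∀ γ ∈ Q.support, LipschitzWith ((G.momentumBound Q).toNNReal / G.δ.toNNReal) γ := by
  obtain ⟨ρ, hρ⟩ := hΩ.exists_isSeparated
  obtain ⟨C, hC0, hC⟩ := G.exists_le_exp_mul hη_pos hη_lip hη_grad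
  obtain ⟨B, hB⟩ := G.η_bdd
  obtain ⟨L, hL⟩ := hΨ
  have S : G.Standing Q ρ C B L := ⟨hρ, hη_pos, hC0, hC, hB, hL, hm₀, hQ⟩
  refine ⟨fun γ hγ => ?_, S.momentumBound_lt_top, fun γ hγ => S.lipschitzWith (hQ.optimal γ hγ)⟩
  obtain ⟨z, hz, -⟩ := S.exists_isMomentum hγ
  exact ⟨z, hz⟩
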